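/- Theorem. Let $M,N\ge 1$, let $\Delta_d=\{u\in\mathbb{R}^d : u_i\ge 0,\ \sum_i u_i=1\}$, and let $G\in[-1,1]^{M\times N}$. Suppose that the matrix game $f(x,y)=x^\top G y$ on $\Delta_M\times\Delta_N$ has a unique Nash equilibrium $z^*=(x^*,y^*)$, that is, a unique point of $\Delta_M\times\Delta_N$ with $f(x^*,y)\le f(x^*,y^*)\le f(x,y^*)$ for all $x\in\Delta_M$, $y\in\Delta_N$. For a step size $\eta>0$, Optimistic Multiplicative Weights Update (OMWU) starts from the uniform distributions $(\hat x_1,\hat y_1)=(x_0,y_0)=(\mathbf 1_M/M,\mathbf 1_N/N)$ and computes, for $t=1,2,\dots$, $$x_{t,i}=\frac{\hat x_{t,i}e^{-\eta (Gy_{t-1})_i}}{\sum_j \hat x_{t,j}e^{-\eta (Gy_{t-1})_j}},\quad \hat x_{t+1,i}=\frac{\hat x_{t,i}e^{-\eta (Gy_{t})_i}}{\sum_j \hat x_{t,j}e^{-\eta (Gy_{t})_j}},\quad y_{t,i}=\frac{\hat y_{t,i}e^{\eta (G^\top x_{t-1})_i}}{\sum_j \hat y_{t,j}e^{\eta (G^\top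 x_{t-1})_j}},\quad \hat y_{t+1,i}=\frac{\hat y_{t,i}e^{\eta (G^\top x_{t})_i}}{\sum_j \hat y_{t,j}e^{\eta (G^\top x_{t})_j}}.$$ Write $z_t=(x_t,y_t)$ and $\mathrm{KL}(z,z')=\sum_i x_i\ln\frac{x_i}{x'_i}+\sum_j y_j\ln\frac{y_j}{y'_j}$ for $z=(x,y)$, $z'=(x',y')$, where $0\ln 0=0$. Then there are constants $A,K,c>0$ depending only on $G$ such that, for every step size $0<\eta\le\frac18$ and every $t\ge 0$, $$\mathrm{KL}(z^*,z_t)\le C_3(1+C_4)^{-t},\qquad C_3=A\,(1+c\eta^2)^{K/\eta^4},\quad C_4=c\,\eta^2 .$$ In particular, for each fixed step size $\eta\in(0,\frac18]$ the last iterate converges linearly in KL divergence, with constants $C_3,C_4>0$ depending only on $G$ and $\eta$. -/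

import Mathlib

namespace MatrixGame

/-- A pair `z = (x, y)` of vectors in `ℝ^M × ℝ^N`. -/
abbrev Profile (M N : ℕ) : Type := (Fin M → ℝ) × (Fin N → ℝ)

/-- The payoff `f(x, y) = xᵀ G y` of a matrix game; `x` minimizes and `y` maximizes. -/
def payoff {M N : ℕ} (G : Matrix (Fin M) (Fin N) ℝ) (x : Fin M → ℝ) (y : Fin N → ℝ) : ℝ :=
  ∑ i, ∑ j, x i * G i j * y j

/-- `z = (x*, y*)` is a Nash equilibrium: both components are probability vectors and
`f(x*, y) ≤ f(x*, y*) ≤ f(x, y*)` for all probability vectors `x`, `y`. -/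
def IsNashEquilibrium {M N : ℕ} (G : Matrix (Fin M) (Fin N) ℝ) (z : Profile M N) : Prop :=
  z.1 ∈ stdSimplex ℝ (Fin M) ∧ z.2 ∈ stdSimplex ℝ (Fin N) ∧
    (∀ y ∈ stdSimplex ℝ (Fin N), payoff G z.1 y ≤ payoff G z.1 z.2) ∧
    (∀ x ∈ stdSimplex ℝ (Fin M), payoff G z.1 z.2 ≤ payoff G x z.2)

/-- The partial gradient `∇ₓ f(x, y) = G y`. -/
def gradX {M N : ℕ} (G : Matrix (Fin M) (Fin N) ℝ) (z : Profile M N) : Fin M → ℝ :=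
  fun i => ∑ j, G i j * z.2 j

/-- The partial gradient `∇_y f(x, y) = Gᵀ x`. -/
def gradY {M N : ℕ} (G : Matrix (Fin M) (Fin N) ℝ) (z : Profile M N) : Fin N → ℝ :=
  fun j => ∑ i, G i j * z.1 i

/-- The Kullback-Leibler divergence `∑ᵢ uᵢ ln (uᵢ / vᵢ)`, with `0 ln 0 = 0`. It is only used
for vectors `v` with positive entries. -/
noncomputable def KL {d : ℕ} (u v : Fin d → ℝ) : ℝ :=
  ∑ i, u i * Real.log (u i / v i)

/-- `KL(z, z') = KL(x, x') + KL(y, y')`. -/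
noncomputable def KLProfile {M N : ℕ} (z z' : Profile M N) : ℝ :=
  KL z.1 z'.1 + KL z.2 z'.2

/-- The exponential reweighting `uᵢ exp(gᵢ) / ∑ⱼ uⱼ exp(gⱼ)`. -/
noncomputable def reweight {d : ℕ} (u g : Fin d → ℝ) : Fin d → ℝ :=
  fun i => u i * Real.exp (g i) / ∑ j, u j * Real.exp (g j)

/-- The multiplicative-weights step of both players from `zhat`, with the gradients taken
at `z` and step size `η` (descent for the first player, ascent for the second). -/
noncomputable def mwuStep {M N : ℕ} (G : Matrix (Fin M) (Fin N) ℝ) (η : ℝ)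
    (zhat z : Profile M N) : Profile M N :=
  (reweight zhat.1 (fun i => -η * gradX G z i), reweight zhat.2 (fun j => η * gradY G z j))

/-- The pair of uniform distributions. -/
noncomputable def uniformProfile (M N : ℕ) : Profile M N :=
  (fun _ => 1 / (M : ℝ), fun _ => 1 / (N : ℝ))

/-- The pair `(z_t, ẑ_{t+1})` of optimistic multiplicative weights update, started at
`z_0 = ẑ_1 = ` the uniform distributions: for `t ≥ 1`, `z_t` is the step from `ẑ_t` with the
gradients at `z_{t-1}`, and `ẑ_{t+1}` is the step from `ẑ_t` with the gradients at `z_t`. -/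
noncomputable def omwuState {M N : ℕ} (G : Matrix (Fin M) (Fin N) ℝ) (η : ℝ) :
    ℕ → Profile M N × Profile M N
  | 0 => (uniformProfile M N, uniformProfile M N)
  | t + 1 =>
    (mwuStep G η (omwuState G η t).2 (omwuState G η t).1,
      mwuStep G η (omwuState G η t).2
        (mwuStep G η (omwuState G η t).2 (omwuState G η t).1))

/-- The iterate `z_t` of optimistic multiplicative weights update. -/
noncomputable def omwu {M N : ℕ} (G : Matrix (Fin M) (Fin N) ℝ) (η : ℝ) (t : ℕ) :
    Profile M N :=
  (omwuState G η t).1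

end MatrixGame

/-!
Write `p` for the equilibrium, `v = ẑ_t`, `z = z_{t-1}`, `w = z_t` and `u = ẑ_{t+1}`. The proof
follows the potential `Θ = KL(p, v) + KL(v, z) / 2` and shows that it contracts by a factor
`1 + c η²` in every step, from the first one on.

*Descent.* `w` and `u` are two exponential reweightings of `v`, which gives an exact three-point
identity (`KL_reweight_eq`). Summed over the players, its first-order term has a sign because `p`
is an equilibrium, and its prediction error is absorbed through Pinsker's inequality, so that
`Θ` drops by at least a quarter of the distance travelled `ζ = KL(u, w) + KL(w, v)`
(`potential_step_le`). In particular `Θ` stays bounded, so the iterates stay bounded away from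
zero on the support of `p`, uniformly in `t` and `η` (`exists_le_of_KL_le`).

*Progress.* The logarithmic increments of a reweighting are the gradient up to a constant. Hence
`ζ` bounds `η²` times the variance of each player's gradient at `u`, under `u`
(`exists_gradient_variance_le`).

*Error bound.* This variance bounds `KL(p, u)` up to a constant (`exists_KL_error_bound`). Small
variance means that both gradients are nearly constant on the supports, with nearly equal
constants, since both means are the payoff at `u`. So the duality gap of `u` against `p` is
small, and strict complementarity bounds the mass off the support of `p`; on the support, the
linear indifference system is injective (`exists_linear_error_bound`). This bounds the distance
from `u` to `p` by the standard deviation. The divergence is quadratic on the support but linear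
off it; there, near `p`, strict complementarity keeps the gradient away from its mean, so that
the mass is bounded by the variance itself (`exists_quadratic_error_bound`).

*Uniqueness* enters twice: it makes the tangent cone of the optimality polytope trivial
(`eq_zero_of_feasible_direction`), which is the injectivity above, and, dually, it implies strict
complementarity (`vecMul_lt_payoff`). The duality step needs no closedness of polyhedral cones,
because a cone with trivial dual is everything (`eq_univ_of_dual_trivial`).
-/

namespace MatrixGame

open Matrix

/-! ### The Kullback-Leibler divergence on the simplex -/

/-- The mass that `q` puts outside the support of `p`. -/
noncomputable def offSupportMass {d : ℕ} (p q : Fin d → ℝ) : ℝ :=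
  ∑ i, if p i = 0 then q i else 0

lemma offSupportMass_nonneg {d : ℕ} {p q : Fin d → ℝ} (hq : ∀ i, 0 ≤ q i) :
    0 ≤ offSupportMass p q :=
  Finset.sum_nonneg fun i _ => by split_ifs <;> simp [hq i]

lemma le_offSupportMass {d : ℕ} {p q : Fin d → ℝ} (hq : ∀ i, 0 ≤ q i) {i : Fin d}
    (hi : p i = 0) : q i ≤ offSupportMass p q := by
  have := Finset.single_le_sum (f := fun i => if p i = 0 then q i else 0)
    (fun j _ => by split_ifs <;> simp [hq j]) (Finset.mem_univ i)
  simpa [offSupportMass, hi] using this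

lemma offSupportMass_le_one {d : ℕ} {p q : Fin d → ℝ} (hq : q ∈ stdSimplex ℝ (Fin d)) :
    offSupportMass p q ≤ 1 := by
  rw [← hq.2]
  exact Finset.sum_le_sum fun i _ => by split_ifs <;> simp [hq.1 i]

/-- Each term of the divergence dominates the corresponding term of the squared Hellinger
distance, up to a correction that sums to zero over the simplex. -/
lemma sq_sqrt_sub_sqrt_le {p q : ℝ} (hp : 0 ≤ p) (hq : 0 < q) :
    (√p - √q) ^ 2 + (p - q) ≤ p * Real.log (p / q) := by
  rcases hp.eq_or_lt with rfl | hp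
  · simp [Real.sq_sqrt hq.le]
  have ha : 0 < √p := Real.sqrt_pos.2 hp
  have hb : 0 < √q := Real.sqrt_pos.2 hq
  have hp2 : √p ^ 2 = p := Real.sq_sqrt hp.le
  have hq2 : √q ^ 2 = q := Real.sq_sqrt hq.le
  have hlog : Real.log (p / q) = -(2 * Real.log (√q / √p)) := by
    rw [Real.log_div hb.ne' ha.ne', Real.log_div hp.ne' hq.ne', Real.log_sqrt hp.le,
      Real.log_sqrt hq.le]
    ring
  have h1 : Real.log (√q / √p) ≤ √q / √p - 1 := Real.log_le_sub_one_of_pos (div_pos hb ha)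
  have h2 : p * (√q / √p) = √p * √q := by
    calc p * (√q / √p) = √p ^ 2 * (√q / √p) := by rw [hp2]
      _ = √p * √q := by field_simp
  have h3 := mul_le_mul_of_nonneg_left h1 hp.le
  rw [hlog]
  nlinarith

lemma sum_sq_sqrt_sub_sqrt_le_KL {d : ℕ} {p q : Fin d → ℝ} (hp : p ∈ stdSimplex ℝ (Fin d))
    (hq : q ∈ stdSimplex ℝ (Fin d)) (hpos : ∀ i, 0 < q i) :
    ∑ i, (√(p i) - √(q i)) ^ 2 ≤ KL p q := by
  have h := Finset.sum_le_sum fun i (_ : i ∈ Finset.univ) =>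
    sq_sqrt_sub_sqrt_le (hp.1 i) (hpos i)
  rw [Finset.sum_add_distrib, Finset.sum_sub_distrib, hp.2, hq.2] at h
  simpa [KL] using h

lemma KL_nonneg {d : ℕ} {p q : Fin d → ℝ} (hp : p ∈ stdSimplex ℝ (Fin d))
    (hq : q ∈ stdSimplex ℝ (Fin d)) (hpos : ∀ i, 0 < q i) : 0 ≤ KL p q :=
  (Finset.sum_nonneg fun _ _ => sq_nonneg _).trans (sum_sq_sqrt_sub_sqrt_le_KL hp hq hpos)

/-- Pinsker's inequality, with a constant twice the optimal one. -/
lemma sq_sum_abs_sub_le_KL {d : ℕ} {p q : Fin d → ℝ} (hp : p ∈ stdSimplex ℝ (Fin d))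
    (hq : q ∈ stdSimplex ℝ (Fin d)) (hpos : ∀ i, 0 < q i) :
    (∑ i, |p i - q i|) ^ 2 ≤ 4 * KL p q := by
  have hfac : ∀ i, |p i - q i| = |√(p i) - √(q i)| * (√(p i) + √(q i)) := fun i => by
    rw [← abs_of_nonneg (add_nonneg (Real.sqrt_nonneg (p i)) (Real.sqrt_nonneg (q i))), ← abs_mul]
    congr 1
    linear_combination -Real.sq_sqrt (hp.1 i) + Real.sq_sqrt (hq.1 i)
  have hsum : ∑ i, (√(p i) + √(q i)) ^ 2 ≤ 4 := by
    calc ∑ i, (√(p i) + √(q i)) ^ 2 ≤ ∑ i, (2 * p i + 2 * q i) :=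
          Finset.sum_le_sum fun i _ => by
            nlinarith [sq_nonneg (√(p i) - √(q i)), Real.sq_sqrt (hp.1 i), Real.sq_sqrt (hq.1 i)]
      _ = 4 := by
          rw [Finset.sum_add_distrib, ← Finset.mul_sum, ← Finset.mul_sum, hp.2, hq.2]
          norm_num
  have hcs := Finset.sum_mul_sq_le_sq_mul_sq Finset.univ (fun i => |√(p i) - √(q i)|)
    (fun i => √(p i) + √(q i))
  simp only [sq_abs] at hcs
  simp_rw [hfac]
  have h1 := sum_sq_sqrt_sub_sqrt_le_KL hp hq hpos
  have h2 : 0 ≤ ∑ i, (√(p i) - √(q i)) ^ 2 := Finset.sum_nonneg fun _ _ => sq_nonneg _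
  nlinarith

lemma sum_sq_sub_le_KL {d : ℕ} {p q : Fin d → ℝ} (hp : p ∈ stdSimplex ℝ (Fin d))
    (hq : q ∈ stdSimplex ℝ (Fin d)) (hpos : ∀ i, 0 < q i) :
    ∑ i, (p i - q i) ^ 2 ≤ 4 * KL p q := by
  refine le_trans ?_ (sq_sum_abs_sub_le_KL hp hq hpos)
  have := Finset.sum_sq_le_sq_sum_of_nonneg (s := Finset.univ) (f := fun i => |p i - q i|)
    (fun i _ => abs_nonneg _)
  simpa only [sq_abs] using this

lemma offSupportMass_le_KL {d : ℕ} {p q : Fin d → ℝ} (hp : p ∈ stdSimplex ℝ (Fin d))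
    (hq : q ∈ stdSimplex ℝ (Fin d)) (hpos : ∀ i, 0 < q i) : offSupportMass p q ≤ KL p q := by
  have h := Finset.sum_le_sum fun i (_ : i ∈ Finset.univ) =>
    show (if p i = 0 then q i else 0) + (p i - q i) ≤ p i * Real.log (p i / q i) by
      split_ifs with h0
      · simp [h0]
      · have := sq_sqrt_sub_sqrt_le (hp.1 i) (hpos i)
        nlinarith [sq_nonneg (√(p i) - √(q i))]
  rw [Finset.sum_add_distrib, Finset.sum_sub_distrib, hp.2, hq.2] at h
  simpa [KL, offSupportMass] using h

/-- An upper bound for the divergence that is quadratic on the support of `p` and linear off it. -/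
lemma KL_le_sum_sq_add_offSupportMass {d : ℕ} {p q : Fin d → ℝ}
    (hp : p ∈ stdSimplex ℝ (Fin d)) (hq : q ∈ stdSimplex ℝ (Fin d)) (hpos : ∀ i, 0 < q i)
    {ε : ℝ} (hε : 0 < ε) (hε1 : ε ≤ 1) (hqε : ∀ i, p i ≠ 0 → ε ≤ q i) :
    KL p q ≤ 1 / ε * (∑ i, (p i - q i) ^ 2 + offSupportMass p q) := by
  have hinv : 1 ≤ 1 / ε := by rw [le_div_iff₀ hε]; linarith
  have h := Finset.sum_le_sum fun i (_ : i ∈ Finset.univ) =>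
    show p i * Real.log (p i / q i) ≤
        1 / ε * ((p i - q i) ^ 2 + if p i = 0 then q i else 0) + (p i - q i) by
      split_ifs with h0
      · have := mul_le_mul_of_nonneg_right hinv (hpos i).le
        have h2 : 0 ≤ 1 / ε * q i ^ 2 := by positivity
        simp only [h0, zero_mul, zero_sub]
        nlinarith
      · have hpi : 0 < p i := lt_of_le_of_ne (hp.1 i) (Ne.symm h0)
        have h1 := mul_le_mul_of_nonneg_left
          (Real.log_le_sub_one_of_pos (div_pos hpi (hpos i))) hpi.le
        have h2 : p i * (p i / q i - 1) = 1 / q i * (p i - q i) ^ 2 + (p i - q i) := by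
          have := (hpos i).ne'
          field_simp
          ring
        have h3 : 1 / q i * (p i - q i) ^ 2 ≤ 1 / ε * (p i - q i) ^ 2 :=
          mul_le_mul_of_nonneg_right (one_div_le_one_div_of_le hε (hqε i h0)) (sq_nonneg _)
        linarith
  rw [Finset.sum_add_distrib, Finset.sum_sub_distrib, hp.2, hq.2, ← Finset.mul_sum,
    Finset.sum_add_distrib] at h
  simpa [KL, offSupportMass] using h

lemma nonempty_of_mem_stdSimplex {d : ℕ} {p : Fin d → ℝ} (hp : p ∈ stdSimplex ℝ (Fin d)) :
    Nonempty (Fin d) := by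
  by_contra hcon
  rw [not_nonempty_iff] at hcon
  have := hp.2
  simp at this

/-- Vectors at bounded divergence from `p` are bounded away from zero on the support of `p`. -/
lemma exists_le_of_KL_le {d : ℕ} {p : Fin d → ℝ} (hp : p ∈ stdSimplex ℝ (Fin d)) (L : ℝ) :
    ∃ ε : ℝ, 0 < ε ∧ ε ≤ 1 ∧ ∀ q ∈ stdSimplex ℝ (Fin d), (∀ i, 0 < q i) → KL p q ≤ L →
      ∀ i, p i ≠ 0 → ε ≤ q i := by
  have := nonempty_of_mem_stdSimplex hp
  obtain ⟨i₀, hi₀⟩ := Finite.exists_min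
    fun i => if p i = 0 then 1 else p i * Real.exp (-((L + 1) / p i))
  set m := if p i₀ = 0 then 1 else p i₀ * Real.exp (-((L + 1) / p i₀)) with hm
  have hm0 : 0 < m := by
    rw [hm]
    split_ifs with h
    · exact one_pos
    · exact mul_pos (lt_of_le_of_ne (hp.1 i₀) (Ne.symm h)) (Real.exp_pos _)
  refine ⟨min m 1, lt_min hm0 one_pos, min_le_right _ _, fun q hq hpos hL i hi => ?_⟩
  have hpi : 0 < p i := lt_of_le_of_ne (hp.1 i) (Ne.symm hi)
  have hterm : ∀ j, 0 ≤ p j * Real.log (p j / q j) - (p j - q j) := fun j => by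
    have := sq_sqrt_sub_sqrt_le (hp.1 j) (hpos j)
    nlinarith [sq_nonneg (√(p j) - √(q j))]
  have h1 := Finset.single_le_sum (f := fun j => p j * Real.log (p j / q j) - (p j - q j))
    (fun j _ => hterm j) (Finset.mem_univ i)
  rw [Finset.sum_sub_distrib, Finset.sum_sub_distrib, hp.2, hq.2] at h1
  have hple : p i ≤ 1 := by
    rw [← hp.2]; exact Finset.single_le_sum (fun j _ => hp.1 j) (Finset.mem_univ i)
  have h2 : p i * Real.log (p i / q i) ≤ L + 1 := by
    have : (∑ j, p j * Real.log (p j / q j)) = KL p q := rfl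
    have := (hpos i).le
    linarith
  have h3 : Real.log (p i / q i) ≤ (L + 1) / p i := by rw [le_div_iff₀ hpi]; linarith
  rw [Real.log_le_iff_le_exp (div_pos hpi (hpos i)), div_le_iff₀ (hpos i)] at h3
  refine (min_le_left _ _).trans ((hi₀ i).trans ?_)
  rw [if_neg hi, Real.exp_neg, ← div_eq_mul_inv, div_le_iff₀ (Real.exp_pos _)]
  linarith

lemma one_add_add_sq_le_exp {s : ℝ} (hs : -2 ≤ s) : 1 + s + s ^ 2 / 4 ≤ Real.exp s := by
  have h := Real.add_one_le_exp (s / 2)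
  have h2 : Real.exp s = Real.exp (s / 2) ^ 2 := by rw [← Real.exp_nat_mul]; congr 1; push_cast; ring
  rw [h2]
  nlinarith

/-- For vectors with bounded ratios the divergence dominates the second moment of the
logarithmic ratio. -/
lemma sum_mul_sq_log_le_KL {d : ℕ} {p q : Fin d → ℝ} (hp : p ∈ stdSimplex ℝ (Fin d))
    (hp0 : ∀ i, 0 < p i) (hq : q ∈ stdSimplex ℝ (Fin d)) (hpos : ∀ i, 0 < q i)
    (hlog : ∀ i, Real.log (p i / q i) ≤ 2) :
    ∑ i, p i * Real.log (p i / q i) ^ 2 ≤ 4 * KL p q := by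
  have h := Finset.sum_le_sum fun i (_ : i ∈ Finset.univ) =>
    show p i * Real.log (p i / q i) ^ 2 ≤ 4 * (p i * Real.log (p i / q i) + (q i - p i)) by
      have h1 := one_add_add_sq_le_exp (s := -Real.log (p i / q i)) (by linarith [hlog i])
      rw [Real.exp_neg, Real.exp_log (div_pos (hp0 i) (hpos i)), inv_div] at h1
      have h2 := mul_le_mul_of_nonneg_left h1 (hp0 i).le
      rw [mul_div_cancel₀ _ (hp0 i).ne'] at h2
      nlinarith
  rw [← Finset.mul_sum, Finset.sum_add_distrib, Finset.sum_sub_distrib, hp.2, hq.2] at h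
  simpa [KL] using h

/-! ### The multiplicative-weights step -/

lemma reweight_normalizer_pos {d : ℕ} {v : Fin d → ℝ} (hv : v ∈ stdSimplex ℝ (Fin d))
    (g : Fin d → ℝ) : 0 < ∑ j, v j * Real.exp (g j) := by
  have hnn : ∀ j ∈ Finset.univ, 0 ≤ v j * Real.exp (g j) :=
    fun j _ => mul_nonneg (hv.1 j) (Real.exp_pos _).le
  refine lt_of_le_of_ne (Finset.sum_nonneg hnn) fun h => ?_
  have h0 := (Finset.sum_eq_zero_iff_of_nonneg hnn).1 h.symm
  have : ∑ j, v j = 0 := Finset.sum_eq_zero fun j hj => by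
    simpa [(Real.exp_pos _).ne'] using h0 j hj
  rw [hv.2] at this
  exact one_ne_zero this

lemma reweight_mem_stdSimplex {d : ℕ} {v : Fin d → ℝ} (hv : v ∈ stdSimplex ℝ (Fin d))
    (g : Fin d → ℝ) : reweight v g ∈ stdSimplex ℝ (Fin d) := by
  have hZ := reweight_normalizer_pos hv g
  refine ⟨fun i => div_nonneg (mul_nonneg (hv.1 i) (Real.exp_pos _).le) hZ.le, ?_⟩
  simp only [reweight]
  rw [← Finset.sum_div, div_self hZ.ne']

lemma reweight_pos {d : ℕ} {v : Fin d → ℝ} (hv : v ∈ stdSimplex ℝ (Fin d))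
    (hv0 : ∀ i, 0 < v i) (g : Fin d → ℝ) (i : Fin d) : 0 < reweight v g i :=
  div_pos (mul_pos (hv0 i) (Real.exp_pos _)) (reweight_normalizer_pos hv g)

lemma log_reweight {d : ℕ} {v : Fin d → ℝ} (hv : v ∈ stdSimplex ℝ (Fin d))
    (hv0 : ∀ i, 0 < v i) (g : Fin d → ℝ) (i : Fin d) :
    Real.log (reweight v g i) =
      Real.log (v i) + g i - Real.log (∑ j, v j * Real.exp (g j)) := by
  rw [reweight, Real.log_div (mul_pos (hv0 i) (Real.exp_pos _)).ne'
    (reweight_normalizer_pos hv g).ne', Real.log_mul (hv0 i).ne' (Real.exp_pos _).ne', Real.log_exp]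

lemma abs_log_reweight_normalizer_le {d : ℕ} {v : Fin d → ℝ} (hv : v ∈ stdSimplex ℝ (Fin d))
    {g : Fin d → ℝ} {B : ℝ} (hg : ∀ i, |g i| ≤ B) :
    |Real.log (∑ j, v j * Real.exp (g j))| ≤ B := by
  have hZ := reweight_normalizer_pos hv g
  rw [abs_le, Real.le_log_iff_exp_le hZ, Real.log_le_iff_le_exp hZ]
  constructor
  · calc Real.exp (-B) = ∑ j, v j * Real.exp (-B) := by rw [← Finset.sum_mul, hv.2, one_mul]
      _ ≤ _ := Finset.sum_le_sum fun j _ => mul_le_mul_of_nonneg_left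
          (Real.exp_le_exp.2 (abs_le.1 (hg j)).1) (hv.1 j)
  · calc _ ≤ ∑ j, v j * Real.exp B := Finset.sum_le_sum fun j _ => mul_le_mul_of_nonneg_left
          (Real.exp_le_exp.2 (abs_le.1 (hg j)).2) (hv.1 j)
      _ = Real.exp B := by rw [← Finset.sum_mul, hv.2, one_mul]

lemma mul_log_div_eq {p q : ℝ} (hq : 0 < q) :
    p * Real.log (p / q) = p * Real.log p - p * Real.log q := by
  rcases eq_or_ne p 0 with rfl | hp
  · simp
  · rw [Real.log_div hp hq.ne']; ring

/-- The three-point identity of optimistic multiplicative weights: `w` is the step from `v` with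
the predicted gradient `a` and `u` the step from `v` with the observed gradient `b`. -/
lemma KL_reweight_eq {d : ℕ} {p v : Fin d → ℝ} (hp : p ∈ stdSimplex ℝ (Fin d))
    (hv : v ∈ stdSimplex ℝ (Fin d)) (hv0 : ∀ i, 0 < v i) (a b : Fin d → ℝ) :
    KL p (reweight v b) = KL p v - KL (reweight v b) (reweight v a) - KL (reweight v a) v
      + ∑ i, (reweight v a i - p i) * b i
      + ∑ i, (reweight v b i - reweight v a i) * (b i - a i) := by
  have hu := reweight_mem_stdSimplex hv b
  have hw := reweight_mem_stdSimplex hv a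
  have hu0 := reweight_pos hv hv0 b
  have hw0 := reweight_pos hv hv0 a
  have lu := log_reweight hv hv0 b
  have lw := log_reweight hv hv0 a
  set α := Real.log (∑ j, v j * Real.exp (a j))
  set β := Real.log (∑ j, v j * Real.exp (b j))
  set u := reweight v b
  set w := reweight v a
  have key : ∀ i, p i * Real.log (p i / u i) - (p i * Real.log (p i / v i)
      - u i * Real.log (u i / w i) - w i * Real.log (w i / v i)
      + (w i - p i) * b i + (u i - w i) * (b i - a i)) = β * p i + (α - β) * u i - α * w i := by
    intro i
    rw [mul_log_div_eq (hu0 i), mul_log_div_eq (hv0 i), mul_log_div_eq (hw0 i),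
      mul_log_div_eq (hv0 i), lu i, lw i]
    ring
  have hs := Finset.sum_congr (rfl : (Finset.univ : Finset (Fin d)) = _) fun i _ => key i
  simp only [Finset.sum_sub_distrib, Finset.sum_add_distrib] at hs
  rw [← Finset.mul_sum, ← Finset.mul_sum, ← Finset.mul_sum, hp.2, hu.2, hw.2] at hs
  simp only [KL]
  linarith

/-- The progress made by a step controls how far the observed gradient is from being constant on
the support of the new iterate. -/
lemma exists_sum_mul_sq_sub_le {d : ℕ} {v : Fin d → ℝ} (hv : v ∈ stdSimplex ℝ (Fin d))
    (hv0 : ∀ i, 0 < v i) {a b : Fin d → ℝ} (ha : ∀ i, |a i| ≤ 1 / 8) (hb : ∀ i, |b i| ≤ 1 / 8) :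
    ∃ r : ℝ, ∑ i, reweight v b i * (b i - r) ^ 2 ≤
      16 * (KL (reweight v b) (reweight v a) + KL (reweight v a) v) := by
  have hu := reweight_mem_stdSimplex hv b
  have hw := reweight_mem_stdSimplex hv a
  have hu0 := reweight_pos hv hv0 b
  have hw0 := reweight_pos hv hv0 a
  have lu := log_reweight hv hv0 b
  have lw := log_reweight hv hv0 a
  have hα := abs_le.1 (abs_log_reweight_normalizer_le hv ha)
  have hβ := abs_le.1 (abs_log_reweight_normalizer_le hv hb)
  set α := Real.log (∑ j, v j * Real.exp (a j))
  set β := Real.log (∑ j, v j * Real.exp (b j))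
  set u := reweight v b
  set w := reweight v a
  have luw : ∀ i, Real.log (u i / w i) = (b i - β) - (a i - α) := fun i => by
    rw [Real.log_div (hu0 i).ne' (hw0 i).ne', lu i, lw i]; ring
  have lwv : ∀ i, Real.log (w i / v i) = a i - α := fun i => by
    rw [Real.log_div (hw0 i).ne' (hv0 i).ne', lw i]; ring
  have h1 := sum_mul_sq_log_le_KL hu hu0 hw hw0 fun i => by
    have := abs_le.1 (ha i); have := abs_le.1 (hb i); rw [luw]; linarith
  have h2 := sum_mul_sq_log_le_KL hw hw0 hv hv0 fun i => by
    have := abs_le.1 (ha i); rw [lwv]; linarith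
  refine ⟨β, ?_⟩
  have hratio : ∀ i, u i ≤ 2 * w i := fun i => by
    have h := Real.add_one_le_exp (-Real.log (u i / w i))
    rw [Real.exp_neg, Real.exp_log (div_pos (hu0 i) (hw0 i)), inv_div, luw, le_div_iff₀ (hu0 i)] at h
    have := abs_le.1 (ha i)
    have := abs_le.1 (hb i)
    nlinarith [hu0 i]
  have hpt := Finset.sum_le_sum fun i (_ : i ∈ Finset.univ) =>
    show u i * (b i - β) ^ 2 ≤
        4 * (u i * Real.log (u i / w i) ^ 2) + 4 * (w i * Real.log (w i / v i) ^ 2) by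
      rw [luw, lwv]
      have e1 : (b i - β) ^ 2 ≤ 2 * ((b i - β) - (a i - α)) ^ 2 + 2 * (a i - α) ^ 2 := by
        nlinarith [sq_nonneg ((b i - β) - 2 * (a i - α))]
      have e2 := mul_le_mul_of_nonneg_left e1 (hu0 i).le
      have e3 := mul_le_mul_of_nonneg_right (hratio i) (sq_nonneg (a i - α))
      have e4 := mul_nonneg (hu0 i).le (sq_nonneg ((b i - β) - (a i - α)))
      nlinarith
  rw [Finset.sum_add_distrib, ← Finset.mul_sum, ← Finset.mul_sum] at hpt
  linarith

/-! ### Equilibria of matrix games -/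

lemma payoff_eq_sum_mulVec {M N : ℕ} (G : Matrix (Fin M) (Fin N) ℝ) (x : Fin M → ℝ)
    (y : Fin N → ℝ) : payoff G x y = ∑ i, x i * (G *ᵥ y) i := by
  simp only [payoff, mulVec, dotProduct, Finset.mul_sum, mul_assoc]

lemma payoff_eq_sum_vecMul {M N : ℕ} (G : Matrix (Fin M) (Fin N) ℝ) (x : Fin M → ℝ)
    (y : Fin N → ℝ) : payoff G x y = ∑ j, y j * (x ᵥ* G) j := by
  simp only [payoff, vecMul, dotProduct, Finset.mul_sum]
  rw [Finset.sum_comm]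
  exact Finset.sum_congr rfl fun j _ => Finset.sum_congr rfl fun i _ => by ring

lemma abs_mulVec_sub_le {M N : ℕ} {G : Matrix (Fin M) (Fin N) ℝ} (hG : ∀ i j, |G i j| ≤ 1)
    (y y' : Fin N → ℝ) (i : Fin M) : |(G *ᵥ y) i - (G *ᵥ y') i| ≤ ∑ j, |y j - y' j| := by
  have h : (G *ᵥ y) i - (G *ᵥ y') i = ∑ j, G i j * (y j - y' j) := by
    simp only [mulVec, dotProduct, mul_sub, Finset.sum_sub_distrib]
  rw [h]
  refine (Finset.abs_sum_le_sum_abs _ _).trans (Finset.sum_le_sum fun j _ => ?_)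
  rw [abs_mul]
  exact mul_le_of_le_one_left (abs_nonneg _) (hG i j)

lemma abs_mulVec_le_one {M N : ℕ} {G : Matrix (Fin M) (Fin N) ℝ} (hG : ∀ i j, |G i j| ≤ 1)
    {y : Fin N → ℝ} (hy : y ∈ stdSimplex ℝ (Fin N)) (i : Fin M) : |(G *ᵥ y) i| ≤ 1 := by
  have h := abs_mulVec_sub_le hG y 0 i
  simp only [mulVec_zero, Pi.zero_apply, sub_zero] at h
  rwa [Finset.sum_congr rfl fun j _ => abs_of_nonneg (hy.1 j), hy.2] at h

lemma abs_vecMul_sub_le {M N : ℕ} {G : Matrix (Fin M) (Fin N) ℝ} (hG : ∀ i j, |G i j| ≤ 1)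
    (x x' : Fin M → ℝ) (j : Fin N) : |(x ᵥ* G) j - (x' ᵥ* G) j| ≤ ∑ i, |x i - x' i| := by
  rw [← mulVec_transpose, ← mulVec_transpose]
  exact abs_mulVec_sub_le (fun j i => hG i j) x x' j

lemma abs_vecMul_le_one {M N : ℕ} {G : Matrix (Fin M) (Fin N) ℝ} (hG : ∀ i j, |G i j| ≤ 1)
    {x : Fin M → ℝ} (hx : x ∈ stdSimplex ℝ (Fin M)) (j : Fin N) : |(x ᵥ* G) j| ≤ 1 := by
  rw [← mulVec_transpose]
  exact abs_mulVec_le_one (fun j i => hG i j) hx j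

lemma IsNashEquilibrium.le_mulVec {M N : ℕ} {G : Matrix (Fin M) (Fin N) ℝ} {x : Fin M → ℝ}
    {y : Fin N → ℝ} (h : IsNashEquilibrium G (x, y)) (i : Fin M) :
    payoff G x y ≤ (G *ᵥ y) i := by
  have := h.2.2.2 (Pi.single i 1) (single_mem_stdSimplex ℝ i)
  rw [payoff_eq_sum_mulVec G (Pi.single i 1)] at this
  simpa [Pi.single_apply] using this

lemma IsNashEquilibrium.vecMul_le {M N : ℕ} {G : Matrix (Fin M) (Fin N) ℝ} {x : Fin M → ℝ}
    {y : Fin N → ℝ} (h : IsNashEquilibrium G (x, y)) (j : Fin N) :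
    (x ᵥ* G) j ≤ payoff G x y := by
  have := h.2.2.1 (Pi.single j 1) (single_mem_stdSimplex ℝ j)
  rw [payoff_eq_sum_vecMul G x (Pi.single j 1)] at this
  simpa [Pi.single_apply] using this

lemma le_payoff_of_le_mulVec {M N : ℕ} {G : Matrix (Fin M) (Fin N) ℝ} {x : Fin M → ℝ}
    {y : Fin N → ℝ} (hx : x ∈ stdSimplex ℝ (Fin M)) {V : ℝ} (hV : ∀ i, V ≤ (G *ᵥ y) i) :
    V ≤ payoff G x y := by
  rw [payoff_eq_sum_mulVec]
  calc V = ∑ i, x i * V := by rw [← Finset.sum_mul, hx.2, one_mul]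
    _ ≤ _ := Finset.sum_le_sum fun i _ => mul_le_mul_of_nonneg_left (hV i) (hx.1 i)

lemma payoff_le_of_vecMul_le {M N : ℕ} {G : Matrix (Fin M) (Fin N) ℝ} {x : Fin M → ℝ}
    {y : Fin N → ℝ} (hy : y ∈ stdSimplex ℝ (Fin N)) {V : ℝ} (hV : ∀ j, (x ᵥ* G) j ≤ V) :
    payoff G x y ≤ V := by
  rw [payoff_eq_sum_vecMul]
  calc _ ≤ ∑ j, y j * V := Finset.sum_le_sum fun j _ => mul_le_mul_of_nonneg_left (hV j) (hy.1 j)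
    _ = V := by rw [← Finset.sum_mul, hy.2, one_mul]

lemma isNashEquilibrium_of_le {M N : ℕ} {G : Matrix (Fin M) (Fin N) ℝ} {x : Fin M → ℝ}
    {y : Fin N → ℝ} (hx : x ∈ stdSimplex ℝ (Fin M)) (hy : y ∈ stdSimplex ℝ (Fin N)) {V : ℝ}
    (hrow : ∀ i, V ≤ (G *ᵥ y) i) (hcol : ∀ j, (x ᵥ* G) j ≤ V) :
    IsNashEquilibrium G (x, y) :=
  ⟨hx, hy,
    fun _ hy' => (payoff_le_of_vecMul_le hy' hcol).trans (le_payoff_of_le_mulVec hx hrow),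
    fun _ hx' => (payoff_le_of_vecMul_le hy hcol).trans (le_payoff_of_le_mulVec hx' hrow)⟩

/-- On the support of the equilibrium strategy all rows are best responses. -/
lemma IsNashEquilibrium.mulVec_eq {M N : ℕ} {G : Matrix (Fin M) (Fin N) ℝ} {x : Fin M → ℝ}
    {y : Fin N → ℝ} (h : IsNashEquilibrium G (x, y)) {i : Fin M} (hi : x i ≠ 0) :
    (G *ᵥ y) i = payoff G x y := by
  have hnn : ∀ k ∈ Finset.univ, 0 ≤ x k * ((G *ᵥ y) k - payoff G x y) := fun k _ =>
    mul_nonneg (h.1.1 k) (sub_nonneg.2 (h.le_mulVec k))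
  have hsum : ∑ k, x k * ((G *ᵥ y) k - payoff G x y) = 0 := by
    simp only [mul_sub, Finset.sum_sub_distrib]
    rw [← Finset.sum_mul, h.1.2, ← payoff_eq_sum_mulVec]
    simp
  have := (Finset.sum_eq_zero_iff_of_nonneg hnn).1 hsum i (Finset.mem_univ i)
  rcases mul_eq_zero.1 this with h0 | h0
  · exact absurd h0 hi
  · linarith

/-- Exchanging the two players turns `G` into `-Gᵀ`. -/
lemma payoff_neg_transpose {M N : ℕ} (G : Matrix (Fin M) (Fin N) ℝ) (x : Fin M → ℝ)
    (y : Fin N → ℝ) : payoff (-Gᵀ) y x = -payoff G x y := by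
  rw [payoff_eq_sum_mulVec, payoff_eq_sum_vecMul, neg_mulVec, mulVec_transpose]
  simp

lemma IsNashEquilibrium.swap {M N : ℕ} {G : Matrix (Fin M) (Fin N) ℝ} {x : Fin M → ℝ}
    {y : Fin N → ℝ} (h : IsNashEquilibrium G (x, y)) : IsNashEquilibrium (-Gᵀ) (y, x) := by
  refine ⟨h.2.1, h.1, fun x' hx' => ?_, fun y' hy' => ?_⟩
  · rw [payoff_neg_transpose, payoff_neg_transpose]
    exact neg_le_neg (h.2.2.2 x' hx')
  · rw [payoff_neg_transpose, payoff_neg_transpose]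
    exact neg_le_neg (h.2.2.1 y' hy')

lemma unique_swap {M N : ℕ} {G : Matrix (Fin M) (Fin N) ℝ} {x : Fin M → ℝ} {y : Fin N → ℝ}
    (huniq : ∀ z, IsNashEquilibrium G z → z = (x, y)) :
    ∀ z, IsNashEquilibrium (-Gᵀ) z → z = (y, x) := by
  rintro ⟨y', x'⟩ h
  have h' := h.swap
  rw [transpose_neg, transpose_transpose, neg_neg] at h'
  have := huniq _ h'
  simp only [Prod.mk.injEq] at this ⊢
  exact this.symm

/-! ### Strict complementarity at a unique equilibrium -/

/-- The maximizer's optimality polytope has trivial tangent cone at a unique equilibrium. -/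
lemma eq_zero_of_feasible_direction {M N : ℕ} {G : Matrix (Fin M) (Fin N) ℝ} {x : Fin M → ℝ}
    {y : Fin N → ℝ} (h : IsNashEquilibrium G (x, y))
    (huniq : ∀ z, IsNashEquilibrium G z → z = (x, y)) {d : Fin N → ℝ} (hsum : ∑ j, d j = 0)
    (hd : ∀ j, y j = 0 → 0 ≤ d j)
    (hGd : ∀ i, (G *ᵥ y) i = payoff G x y → 0 ≤ (G *ᵥ d) i) : d = 0 := by
  -- Slack constraints survive a small step, tight ones are preserved by the assumptions on `d`.
  have hsmall : ∀ a b : ℝ, 0 ≤ a → (a = 0 → 0 ≤ b) →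
      ∀ᶠ τ in nhdsWithin (0 : ℝ) (Set.Ioi 0), 0 ≤ a + τ * b := by
    intro a b ha hab
    rcases ha.eq_or_lt with rfl | ha
    · filter_upwards [self_mem_nhdsWithin] with τ hτ
      have := mul_nonneg (le_of_lt hτ) (hab rfl)
      linarith
    · have hc : Filter.Tendsto (fun τ : ℝ => a + τ * b) (nhds 0) (nhds (a + 0 * b)) :=
        Continuous.tendsto (by fun_prop) 0
      rw [zero_mul, add_zero] at hc
      exact nhdsWithin_le_nhds ((hc.eventually (lt_mem_nhds ha)).mono fun _ => le_of_lt)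
  have h1 : ∀ᶠ τ in nhdsWithin (0 : ℝ) (Set.Ioi 0), ∀ j, 0 ≤ y j + τ * d j :=
    Filter.eventually_all.2 fun j => hsmall _ _ (h.2.1.1 j) (hd j)
  have h2 : ∀ᶠ τ in nhdsWithin (0 : ℝ) (Set.Ioi 0),
      ∀ i, 0 ≤ ((G *ᵥ y) i - payoff G x y) + τ * (G *ᵥ d) i :=
    Filter.eventually_all.2 fun i => hsmall _ _ (sub_nonneg.2 (h.le_mulVec i))
      fun h0 => hGd i (by linarith)
  obtain ⟨τ, ⟨hτ1, hτ2⟩, hτ⟩ := ((h1.and h2).and self_mem_nhdsWithin).exists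
  have hτ0 : (0 : ℝ) < τ := hτ
  have hne : IsNashEquilibrium G (x, y + τ • d) := by
    refine isNashEquilibrium_of_le (V := payoff G x y) h.1 ⟨fun j => ?_, ?_⟩ (fun i => ?_)
      h.vecMul_le
    · simpa using hτ1 j
    · simp only [Pi.add_apply, Pi.smul_apply, smul_eq_mul]
      rw [Finset.sum_add_distrib, ← Finset.mul_sum, hsum, h.2.1.2]
      simp
    · rw [mulVec_add, mulVec_smul]
      have := hτ2 i
      simp only [Pi.add_apply, Pi.smul_apply, smul_eq_mul]
      linarith
  have heq := congrArg Prod.snd (huniq _ hne)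
  simp only [add_eq_left, smul_eq_zero] at heq
  exact heq.resolve_left hτ0.ne'

/-- A convex cone whose dual cone is trivial is the whole space. No closedness is needed: such a
cone is dense, and a dense convex set in finite dimension is everything. -/
lemma eq_univ_of_dual_trivial {ι : Type*} [Fintype ι] {C : Set (ι → ℝ)} (hconv : Convex ℝ C)
    (h0 : 0 ∈ C) (hsmul : ∀ t : ℝ, 0 ≤ t → ∀ v ∈ C, t • v ∈ C)
    (hdual : ∀ d : ι → ℝ, (∀ v ∈ C, 0 ≤ ∑ i, d i * v i) → d = 0) : C = Set.univ := by
  classical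
  have hlin : ∀ f : (ι → ℝ) →ₗ[ℝ] ℝ, (∀ v ∈ C, 0 ≤ f v) → f = 0 := fun f hf => by
    have hrep : ∀ v, f v = ∑ i, f (fun j => if i = j then 1 else 0) * v i := fun v => by
      rw [f.pi_apply_eq_sum_univ v]
      simp [mul_comm]
    have hd := hdual (fun i => f (fun j => if i = j then 1 else 0))
      fun v hv => by rw [← hrep]; exact hf v hv
    ext1 i
    ext1
    simp only [LinearMap.coe_comp, Function.comp_apply, LinearMap.zero_apply]
    rw [hrep]
    exact Finset.sum_eq_zero fun k _ => by rw [congrFun hd k]; simp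
  have hint : (interior C).Nonempty := by
    rw [hconv.interior_nonempty_iff_affineSpan_eq_top,
      AffineSubspace.affineSpan_eq_top_iff_vectorSpan_eq_top_of_nonempty ℝ _ _ ⟨0, h0⟩]
    by_contra hne
    obtain ⟨f, hf, hker⟩ := Submodule.exists_le_ker_of_lt_top _ (lt_top_iff_ne_top.2 hne)
    refine hf (hlin f fun v hv => ?_)
    have := hker (vsub_mem_vectorSpan ℝ hv h0)
    rw [vsub_eq_sub, sub_zero, LinearMap.mem_ker] at this
    exact this.ge
  refine Set.eq_univ_of_forall fun v => ?_
  by_contra hv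
  obtain ⟨f, hf, hfv⟩ := geometric_hahn_banach_of_nonempty_interior_point hconv
    (fun hmem => hv (interior_subset hmem)) hint
  have hneg : ∀ c ∈ C, f c ≤ 0 := fun c hc => by
    -- Otherwise `f` would be unbounded above on the ray through `c`.
    by_contra hpos
    push Not at hpos
    have hfv0 : 0 ≤ f v := by simpa using hfv 0 h0
    have h1 := hfv _ (hsmul ((f v + 1) / f c) (by positivity) c hc)
    rw [map_smul, smul_eq_mul, div_mul_cancel₀ _ hpos.ne'] at h1
    linarith
  have hz := hlin (-(f : (ι → ℝ) →ₗ[ℝ] ℝ)) fun c hc => by simpa using hneg c hc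
  refine hf (ContinuousLinearMap.ext fun w => ?_)
  simpa using LinearMap.congr_fun hz w

/-- Strict complementarity. By uniqueness the maximizer's tangent cone is trivial, so every vector
lies in the cone spanned by its constraints. Expressing `-e_j` in this way yields a
direction for the minimizer that keeps it optimal and makes column `j` strictly suboptimal; by
uniqueness again, column `j` is already strictly suboptimal against `x`. -/
lemma vecMul_lt_payoff {M N : ℕ} {G : Matrix (Fin M) (Fin N) ℝ} {x : Fin M → ℝ}
    {y : Fin N → ℝ} (h : IsNashEquilibrium G (x, y))
    (huniq : ∀ z, IsNashEquilibrium G z → z = (x, y)) {j : Fin N} (hj : y j = 0) :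
    (x ᵥ* G) j < payoff G x y := by
  set V := payoff G x y with hV
  let C : Set (Fin N → ℝ) := {v | ∃ (a : Fin N → ℝ) (b : ℝ) (c : Fin M → ℝ),
    (∀ k, 0 ≤ a k) ∧ (∀ k, y k ≠ 0 → a k = 0) ∧ (∀ i, 0 ≤ c i) ∧
    (∀ i, (G *ᵥ y) i ≠ V → c i = 0) ∧ v = a + b • 1 + c ᵥ* G}
  have hsmul : ∀ t : ℝ, 0 ≤ t → ∀ v ∈ C, t • v ∈ C := by
    rintro t ht _ ⟨a, b, c, ha, ha', hc, hc', rfl⟩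
    refine ⟨t • a, t * b, t • c, fun k => mul_nonneg ht (ha k), fun k hk => by simp [ha' k hk],
      fun i => mul_nonneg ht (hc i), fun i hi => by simp [hc' i hi], ?_⟩
    rw [smul_vecMul, smul_add, smul_add, smul_smul]
  have hadd : ∀ v ∈ C, ∀ w ∈ C, v + w ∈ C := by
    rintro _ ⟨a, b, c, ha, ha', hc, hc', rfl⟩ _ ⟨a₂, b₂, c₂, ha₂, ha₂', hc₂, hc₂', rfl⟩
    refine ⟨a + a₂, b + b₂, c + c₂, fun k => add_nonneg (ha k) (ha₂ k),
      fun k hk => by simp [ha' k hk, ha₂' k hk], fun i => add_nonneg (hc i) (hc₂ i),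
      fun i hi => by simp [hc' i hi, hc₂' i hi], ?_⟩
    rw [add_vecMul, add_smul]
    abel
  have hconv : Convex ℝ C := fun v hv w hw s t hs ht _ =>
    hadd _ (hsmul s hs v hv) _ (hsmul t ht w hw)
  have huniv : C = Set.univ := by
    refine eq_univ_of_dual_trivial hconv
      ⟨0, 0, 0, fun _ => le_rfl, fun _ _ => rfl, fun _ => le_rfl, fun _ _ => rfl, by simp⟩
      hsmul fun d hd => ?_
    refine eq_zero_of_feasible_direction h huniq ?_ (fun k hk => ?_) (fun i hi => ?_)
    · have h1 := hd (1 : Fin N → ℝ) ⟨0, 1, 0, fun _ => le_rfl, fun _ _ => rfl, fun _ => le_rfl,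
        fun _ _ => rfl, by simp⟩
      have h2 := hd (-1 : Fin N → ℝ) ⟨0, -1, 0, fun _ => le_rfl, fun _ _ => rfl, fun _ => le_rfl,
        fun _ _ => rfl, by simp⟩
      simp at h1 h2
      linarith
    · have h1 := hd (Pi.single k 1) ⟨Pi.single k 1, 0, 0,
        fun l => by rw [Pi.single_apply]; split_ifs <;> simp,
        fun l hl => by
          rw [Pi.single_apply, if_neg]
          rintro rfl
          exact hl hk,
        fun _ => le_rfl, fun _ _ => rfl, by simp⟩
      simpa [Pi.single_apply] using h1
    · have h1 := hd (Pi.single i 1 ᵥ* G) ⟨0, 0, Pi.single i 1, fun _ => le_rfl, fun _ _ => rfl,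
        fun l => by rw [Pi.single_apply]; split_ifs <;> simp,
        fun l hl => by
          rw [Pi.single_apply, if_neg]
          rintro rfl
          exact hl hi, by simp⟩
      simpa [mulVec, dotProduct, mul_comm] using h1
  obtain ⟨a, b, c, ha, ha', hc, hc', hv⟩ : -Pi.single j 1 ∈ C := by rw [huniv]; trivial
  have hcG : ∀ k, (c ᵥ* G) k = -(Pi.single j 1 : Fin N → ℝ) k - a k - b := fun k => by
    have := congrFun hv k
    simp only [Pi.neg_apply, Pi.add_apply, Pi.smul_apply, Pi.one_apply, smul_eq_mul,
      mul_one] at this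
    linarith
  -- Pairing the representation of `-e_j` with `y` identifies the multiplier of the constraint
  -- that the entries sum to one.
  have hb : V * ∑ i, c i = -b := by
    have e1 : payoff G c y = V * ∑ i, c i := by
      rw [payoff_eq_sum_mulVec, Finset.mul_sum]
      refine Finset.sum_congr rfl fun i _ => ?_
      by_cases hi : (G *ᵥ y) i = V
      · rw [hi, mul_comm]
      · simp [hc' i hi]
    have e2 : payoff G c y = -b := by
      rw [payoff_eq_sum_vecMul]
      calc ∑ k, y k * (c ᵥ* G) k = ∑ k, y k * (-b) := Finset.sum_congr rfl fun k _ => by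
            rw [hcG k]
            by_cases hk : y k = 0
            · simp [hk]
            · have : k ≠ j := fun hkj => hk (hkj ▸ hj)
              simp [ha' k hk, this]
        _ = -b := by rw [← Finset.sum_mul, h.2.1.2, one_mul]
    rw [← e1, e2]
  set s := ∑ i, c i with hs
  have hs0 : 0 ≤ s := Finset.sum_nonneg fun i _ => hc i
  have hs1 : 0 < 1 + s := by linarith
  have hcol : ∀ k, (((1 + s)⁻¹ • (x + c)) ᵥ* G) k ≤
      V - (1 + s)⁻¹ * (Pi.single j 1 : Fin N → ℝ) k := by
    intro k
    rw [smul_vecMul, add_vecMul]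
    simp only [Pi.smul_apply, Pi.add_apply, smul_eq_mul]
    rw [hcG k, inv_mul_eq_div, inv_mul_eq_div, ← sub_nonneg]
    have h1 : V - (Pi.single j 1 : Fin N → ℝ) k / (1 + s)
        - ((x ᵥ* G) k + (-(Pi.single j 1 : Fin N → ℝ) k - a k - b)) / (1 + s)
        = (V - (x ᵥ* G) k + a k) / (1 + s) := by
      field_simp
      linear_combination hb
    rw [h1]
    exact div_nonneg (by linarith [h.vecMul_le k, ha k]) hs1.le
  have hne : IsNashEquilibrium G ((1 + s)⁻¹ • (x + c), y) := by
    refine isNashEquilibrium_of_le (V := V) ⟨fun i => ?_, ?_⟩ h.2.1 h.le_mulVec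
      fun k => (hcol k).trans ?_
    · exact mul_nonneg (inv_nonneg.2 hs1.le) (add_nonneg (h.1.1 i) (hc i))
    · simp only [Pi.smul_apply, Pi.add_apply, smul_eq_mul]
      rw [← Finset.mul_sum, Finset.sum_add_distrib, h.1.2, ← hs, inv_mul_cancel₀ hs1.ne']
    · have : 0 ≤ (1 + s)⁻¹ * (Pi.single j 1 : Fin N → ℝ) k := by
        refine mul_nonneg (inv_nonneg.2 hs1.le) ?_
        rw [Pi.single_apply]
        split_ifs <;> simp
      linarith
  have heq := congrArg Prod.fst (huniq _ hne)
  simp only at heq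
  have hfin := hcol j
  rw [heq, Pi.single_eq_same] at hfin
  have := inv_pos.2 hs1
  linarith

lemma payoff_lt_mulVec {M N : ℕ} {G : Matrix (Fin M) (Fin N) ℝ} {x : Fin M → ℝ}
    {y : Fin N → ℝ} (h : IsNashEquilibrium G (x, y))
    (huniq : ∀ z, IsNashEquilibrium G z → z = (x, y)) {i : Fin M} (hi : x i = 0) :
    payoff G x y < (G *ᵥ y) i := by
  have := vecMul_lt_payoff h.swap (unique_swap huniq) hi
  rw [payoff_neg_transpose, vecMul_neg, vecMul_transpose] at this
  simpa using this

/-! ### Error bounds around a unique equilibrium -/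

lemma exists_gap_vecMul {M N : ℕ} {G : Matrix (Fin M) (Fin N) ℝ} {x : Fin M → ℝ}
    {y : Fin N → ℝ} (h : IsNashEquilibrium G (x, y))
    (huniq : ∀ z, IsNashEquilibrium G z → z = (x, y)) :
    ∃ ξ : ℝ, 0 < ξ ∧ ∀ j, y j = 0 → (x ᵥ* G) j + ξ ≤ payoff G x y := by
  have := nonempty_of_mem_stdSimplex h.2.1
  obtain ⟨j₀, hj₀⟩ := Finite.exists_min
    fun j => if y j = 0 then payoff G x y - (x ᵥ* G) j else 1
  refine ⟨if y j₀ = 0 then payoff G x y - (x ᵥ* G) j₀ else 1, ?_, fun j hj => ?_⟩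
  · split_ifs with h0
    · linarith [vecMul_lt_payoff h huniq h0]
    · exact one_pos
  · have := hj₀ j
    rw [if_pos hj] at this
    linarith

lemma exists_gap_mulVec {M N : ℕ} {G : Matrix (Fin M) (Fin N) ℝ} {x : Fin M → ℝ}
    {y : Fin N → ℝ} (h : IsNashEquilibrium G (x, y))
    (huniq : ∀ z, IsNashEquilibrium G z → z = (x, y)) :
    ∃ ξ : ℝ, 0 < ξ ∧ ∀ i, x i = 0 → payoff G x y + ξ ≤ (G *ᵥ y) i := by
  obtain ⟨ξ, hξ, hgap⟩ := exists_gap_vecMul h.swap (unique_swap huniq)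
  refine ⟨ξ, hξ, fun i hi => ?_⟩
  have := hgap i hi
  rw [payoff_neg_transpose, vecMul_neg, vecMul_transpose, Pi.neg_apply] at this
  linarith

/-- A direction along which all equilibrium rows stay indifferent and no mass leaves the support
is zero; quantitatively, it is controlled by the violation of these conditions. -/
lemma exists_abs_le_of_violation {M N : ℕ} {G : Matrix (Fin M) (Fin N) ℝ} {x : Fin M → ℝ}
    {y : Fin N → ℝ} (h : IsNashEquilibrium G (x, y))
    (huniq : ∀ z, IsNashEquilibrium G z → z = (x, y)) :
    ∃ K : ℝ, 0 < K ∧ ∀ (d : Fin N → ℝ) (t : ℝ), ∑ j, d j = 0 → 0 ≤ t →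
      (∀ i, x i ≠ 0 → |(G *ᵥ d) i| ≤ t) → (∀ j, y j = 0 → |d j| ≤ t) → ∀ j, |d j| ≤ K * t := by
  let D : (Fin N → ℝ) →ₗ[ℝ] (Fin M → ℝ) × (Fin N → ℝ) × ℝ :=
    { toFun := fun d => (fun i => if x i = 0 then 0 else (G *ᵥ d) i,
        fun j => if y j = 0 then d j else 0, ∑ j, d j)
      map_add' := fun d e => by
        refine Prod.ext ?_ (Prod.ext ?_ ?_)
        · funext i
          simp only [mulVec_add, Prod.fst_add, Pi.add_apply]
          split_ifs <;> simp
        · funext j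
          simp only [Prod.snd_add, Prod.fst_add, Pi.add_apply]
          split_ifs <;> simp
        · simp [Finset.sum_add_distrib]
      map_smul' := fun t d => by
        refine Prod.ext ?_ (Prod.ext ?_ ?_)
        · funext i
          simp [mulVec_smul]
        · funext j
          simp
        · simp [Finset.mul_sum] }
  have hker : LinearMap.ker D = ⊥ := by
    rw [LinearMap.ker_eq_bot']
    intro d hd
    have h1 : ∀ i, (if x i = 0 then 0 else (G *ᵥ d) i) = 0 :=
      fun i => congrFun (congrArg Prod.fst hd) i
    have h2 : ∀ j, (if y j = 0 then d j else 0) = 0 :=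
      fun j => congrFun (congrArg (fun p => p.2.1) hd) j
    have h3 : ∑ j, d j = 0 := congrArg (fun p => p.2.2) hd
    refine eq_zero_of_feasible_direction h huniq h3 (fun j hj => ?_) fun i hi => ?_
    · have := h2 j
      rw [if_pos hj] at this
      exact this.ge
    · -- By strict complementarity the tight rows are those in the support of `x`.
      have hxi : x i ≠ 0 := fun h0 => (payoff_lt_mulVec h huniq h0).ne' hi
      have := h1 i
      rw [if_neg hxi] at this
      exact this.ge
  obtain ⟨K, hK, hanti⟩ := D.exists_antilipschitzWith hker
  refine ⟨K, hK, fun d t hsum ht hG hoff j => ?_⟩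
  have h1 := hanti.le_mul_dist d 0
  rw [map_zero, dist_zero_right, dist_zero_right] at h1
  refine (norm_le_pi_norm d j).trans (h1.trans (mul_le_mul_of_nonneg_left ?_ hK.le))
  refine norm_prod_le_iff.2 ⟨(pi_norm_le_iff_of_nonneg ht).2 fun i => ?_,
    norm_prod_le_iff.2 ⟨(pi_norm_le_iff_of_nonneg ht).2 fun k => ?_, ?_⟩⟩
  · change ‖if x i = 0 then 0 else (G *ᵥ d) i‖ ≤ t
    split_ifs with h0
    · simpa using ht
    · exact hG i h0
  · change ‖if y k = 0 then d k else 0‖ ≤ t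
    split_ifs with h0
    · exact hoff k h0
    · simpa using ht
  · change ‖∑ j, d j‖ ≤ t
    rw [hsum, norm_zero]
    exact ht

lemma abs_sub_le_of_sum_mul_sq_le {d : ℕ} {q g : Fin d → ℝ} (hq : ∀ i, 0 ≤ q i) {r ε E : ℝ}
    (hε : 0 < ε) (hE : 0 ≤ E) (hsum : ∑ i, q i * (g i - r) ^ 2 ≤ E ^ 2) {i : Fin d}
    (hi : ε ≤ q i) : |g i - r| ≤ 1 / √ε * E := by
  have h1 := (Finset.single_le_sum (f := fun i => q i * (g i - r) ^ 2)
    (fun j _ => mul_nonneg (hq j) (sq_nonneg _)) (Finset.mem_univ i)).trans hsum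
  have h2 : ε * (g i - r) ^ 2 ≤ E ^ 2 :=
    (mul_le_mul_of_nonneg_right hi (sq_nonneg _)).trans h1
  have h3 : 0 ≤ 1 / √ε * E := mul_nonneg (by positivity) hE
  refine abs_le_of_sq_le_sq ?_ h3
  rw [mul_pow, div_pow, Real.sq_sqrt hε.le, one_pow, one_div_mul_eq_div, le_div_iff₀ hε]
  linarith

lemma abs_sum_mul_sub_le {d : ℕ} {q g : Fin d → ℝ} (hq : q ∈ stdSimplex ℝ (Fin d)) {r E : ℝ}
    (hE : 0 ≤ E) (hsum : ∑ i, q i * (g i - r) ^ 2 ≤ E ^ 2) : |∑ i, q i * g i - r| ≤ E := by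
  refine abs_le_of_sq_le_sq ?_ hE
  have h1 := Real.pow_arith_mean_le_arith_mean_pow_of_even Finset.univ q (fun i => g i - r)
    (fun i _ => hq.1 i) hq.2 even_two
  have h2 : ∑ i, q i * (g i - r) = ∑ i, q i * g i - r := by
    simp only [mul_sub, Finset.sum_sub_distrib]
    rw [← Finset.sum_mul, hq.2, one_mul]
  rw [h2] at h1
  exact h1.trans hsum

lemma abs_sum_mul_sub_le_of_support {d : ℕ} {p g : Fin d → ℝ} (hp : p ∈ stdSimplex ℝ (Fin d))
    {r B : ℝ} (hB : ∀ i, p i ≠ 0 → |g i - r| ≤ B) : |∑ i, p i * g i - r| ≤ B := by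
  have h2 : ∑ i, p i * g i - r = ∑ i, p i * (g i - r) := by
    simp only [mul_sub, Finset.sum_sub_distrib]
    rw [← Finset.sum_mul, hp.2, one_mul]
  rw [h2]
  calc _ ≤ ∑ i, |p i * (g i - r)| := Finset.abs_sum_le_sum_abs _ _
    _ ≤ ∑ i, p i * B := Finset.sum_le_sum fun i _ => by
        by_cases hi : p i = 0
        · simp [hi]
        · rw [abs_mul, abs_of_nonneg (hp.1 i)]
          exact mul_le_mul_of_nonneg_left (hB i hi) (hp.1 i)
    _ = B := by rw [← Finset.sum_mul, hp.2, one_mul]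

/-- If both gradients are nearly constant, then `y'` is near the equilibrium. The mean of each
gradient is the payoff at `(x', y')`, so both constants nearly agree; this bounds the duality gap
of `(x', y')` against `(x, y)`, hence by strict complementarity the mass off the support. -/
lemma exists_linear_error_bound {M N : ℕ} {G : Matrix (Fin M) (Fin N) ℝ} {x : Fin M → ℝ}
    {y : Fin N → ℝ} (h : IsNashEquilibrium G (x, y))
    (huniq : ∀ z, IsNashEquilibrium G z → z = (x, y)) {ε : ℝ} (hε : 0 < ε) :
    ∃ C : ℝ, 0 < C ∧ ∀ x' ∈ stdSimplex ℝ (Fin M), ∀ y' ∈ stdSimplex ℝ (Fin N),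
      (∀ i, x i ≠ 0 → ε ≤ x' i) → (∀ j, y j ≠ 0 → ε ≤ y' j) → ∀ r s E : ℝ, 0 ≤ E →
      ∑ i, x' i * ((G *ᵥ y') i - r) ^ 2 + ∑ j, y' j * ((x' ᵥ* G) j - s) ^ 2 ≤ E ^ 2 →
      |r - payoff G x y| ≤ C * E ∧ ∀ j, |y' j - y j| ≤ C * E := by
  obtain ⟨K, hK, hlip⟩ := exists_abs_le_of_violation h huniq
  obtain ⟨ξ, hξ, hgap⟩ := exists_gap_vecMul h huniq
  set k := 1 / √ε with hk
  have hk0 : 0 < k := by positivity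
  set V := payoff G x y with hV
  refine ⟨(K + 1) * ((2 * k + 2) * (1 + 1 / ξ)), by positivity,
    fun x' hx' y' hy' hxε hyε r s E hE hsum => ?_⟩
  have hsx : 0 ≤ ∑ i, x' i * ((G *ᵥ y') i - r) ^ 2 :=
    Finset.sum_nonneg fun i _ => mul_nonneg (hx'.1 i) (sq_nonneg _)
  have hsy : 0 ≤ ∑ j, y' j * ((x' ᵥ* G) j - s) ^ 2 :=
    Finset.sum_nonneg fun i _ => mul_nonneg (hy'.1 i) (sq_nonneg _)
  have hsumx : ∑ i, x' i * ((G *ᵥ y') i - r) ^ 2 ≤ E ^ 2 := by linarith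
  have hsumy : ∑ j, y' j * ((x' ᵥ* G) j - s) ^ 2 ≤ E ^ 2 := by linarith
  have hrow : ∀ i, x i ≠ 0 → |(G *ᵥ y') i - r| ≤ k * E := fun i hi =>
    abs_sub_le_of_sum_mul_sq_le hx'.1 hε hE hsumx (hxε i hi)
  have hcol : ∀ j, y j ≠ 0 → |(x' ᵥ* G) j - s| ≤ k * E := fun j hj =>
    abs_sub_le_of_sum_mul_sq_le hy'.1 hε hE hsumy (hyε j hj)
  have hr := abs_le.1 (abs_sum_mul_sub_le hx' hE hsumx)
  have hs := abs_le.1 (abs_sum_mul_sub_le hy' hE hsumy)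
  have hxr := abs_le.1 (abs_sum_mul_sub_le_of_support h.1 hrow)
  have hys := abs_le.1 (abs_sum_mul_sub_le_of_support h.2.1 hcol)
  rw [← payoff_eq_sum_mulVec] at hr hxr
  rw [← payoff_eq_sum_vecMul] at hs hys
  have hlow : V ≤ payoff G x' y := h.2.2.2 x' hx'
  have hoff : payoff G x y' + ξ * offSupportMass y y' ≤ V := by
    have h1 : V = ∑ j, y' j * V := by rw [← Finset.sum_mul, hy'.2, one_mul]
    rw [payoff_eq_sum_vecMul, offSupportMass, Finset.mul_sum, ← Finset.sum_add_distrib, h1]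
    refine Finset.sum_le_sum fun j _ => ?_
    split_ifs with hj
    · have := mul_le_mul_of_nonneg_left (hgap j hj) (hy'.1 j)
      linarith
    · have := mul_le_mul_of_nonneg_left (h.vecMul_le j) (hy'.1 j)
      linarith
  have hoff0 : 0 ≤ offSupportMass y y' := offSupportMass_nonneg hy'.1
  have hξoff : 0 ≤ ξ * offSupportMass y y' := mul_nonneg hξ.le hoff0
  have hkE : 0 ≤ k * E := mul_nonneg hk0.le hE
  have hmass : offSupportMass y y' ≤ (2 * k + 2) * (1 / ξ) * E := by
    rw [mul_one_div, div_mul_eq_mul_div, le_div_iff₀ hξ]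
    linarith
  have hrV : |r - V| ≤ (k + 2) * E := by
    rw [abs_le]
    constructor <;> linarith
  set t := (2 * k + 2) * (1 + 1 / ξ) * E with ht
  have hinv : 0 < 1 / ξ := by positivity
  have ht1 : (2 * k + 2) * E ≤ t := by
    rw [ht]
    nlinarith [mul_nonneg (mul_nonneg (by linarith : (0 : ℝ) ≤ 2 * k + 2) hinv.le) hE]
  have ht2 : (2 * k + 2) * (1 / ξ) * E ≤ t := by
    rw [ht]
    nlinarith
  have ht0 : 0 ≤ t := by positivity
  have hKt : (K + 1) * ((2 * k + 2) * (1 + 1 / ξ)) * E = K * t + t := by rw [ht]; ring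
  rw [hKt]
  refine ⟨by nlinarith, fun j => ?_⟩
  have := hlip (fun j => y' j - y j) t ?_ ht0 ?_ ?_ j
  · exact this.trans (by linarith)
  · rw [Finset.sum_sub_distrib, hy'.2, h.2.1.2, sub_self]
  · intro i hi
    have e1 : (G *ᵥ fun j => y' j - y j) i = (G *ᵥ y') i - r + (r - V) := by
      have : (fun j => y' j - y j) = y' - y := rfl
      rw [this, mulVec_sub, Pi.sub_apply, h.mulVec_eq hi]
      ring
    rw [e1]
    refine (abs_add_le _ _).trans ((add_le_add (hrow i hi) hrV).trans ?_)
    linarith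
  · intro j hj
    simp only [hj, sub_zero]
    rw [abs_of_nonneg (hy'.1 j)]
    exact (le_offSupportMass hy'.1 hj).trans (hmass.trans ht2)

/-- The mass off the support is bounded quadratically. Far from the equilibrium this is trivial;
near it, the rows off the support are worse than the mean by a fixed amount. -/
lemma exists_quadratic_error_bound {M N : ℕ} {G : Matrix (Fin M) (Fin N) ℝ}
    (hG : ∀ i j, |G i j| ≤ 1) {x : Fin M → ℝ}
    {y : Fin N → ℝ} (h : IsNashEquilibrium G (x, y))
    (huniq : ∀ z, IsNashEquilibrium G z → z = (x, y)) {ε : ℝ} (hε : 0 < ε) :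
    ∃ C : ℝ, 0 < C ∧ ∀ x' ∈ stdSimplex ℝ (Fin M), ∀ y' ∈ stdSimplex ℝ (Fin N),
      (∀ i, x i ≠ 0 → ε ≤ x' i) → (∀ j, y j ≠ 0 → ε ≤ y' j) → ∀ r s : ℝ,
      ∑ j, (y j - y' j) ^ 2 + offSupportMass x x' ≤
        C * (∑ i, x' i * ((G *ᵥ y') i - r) ^ 2 + ∑ j, y' j * ((x' ᵥ* G) j - s) ^ 2) := by
  obtain ⟨C, hC, hlin⟩ := exists_linear_error_bound h huniq hε
  obtain ⟨ξ, hξ, hgap⟩ := exists_gap_mulVec h huniq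
  set δ := ξ / (2 * ((N + 1) * C)) with hδ
  have hδ0 : 0 < δ := by positivity
  refine ⟨N * C ^ 2 + 4 / ξ ^ 2 + 1 / δ ^ 2, by positivity,
    fun x' hx' y' hy' hxε hyε r s => ?_⟩
  have hsx : 0 ≤ ∑ i, x' i * ((G *ᵥ y') i - r) ^ 2 :=
    Finset.sum_nonneg fun i _ => mul_nonneg (hx'.1 i) (sq_nonneg _)
  have hsy : 0 ≤ ∑ j, y' j * ((x' ᵥ* G) j - s) ^ 2 :=
    Finset.sum_nonneg fun i _ => mul_nonneg (hy'.1 i) (sq_nonneg _)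
  set e := ∑ i, x' i * ((G *ᵥ y') i - r) ^ 2 + ∑ j, y' j * ((x' ᵥ* G) j - s) ^ 2 with he
  have he0 : 0 ≤ e := add_nonneg hsx hsy
  have hEe : √e ^ 2 = e := Real.sq_sqrt he0
  have hE0 : 0 ≤ √e := Real.sqrt_nonneg e
  obtain ⟨hr, hy⟩ := hlin x' hx' y' hy' hxε hyε r s (√e) hE0 hEe.ge
  have hsq : ∑ j, (y j - y' j) ^ 2 ≤ N * C ^ 2 * e := by
    calc ∑ j, (y j - y' j) ^ 2 ≤ ∑ _j : Fin N, C ^ 2 * e := Finset.sum_le_sum fun j _ => by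
          rw [← hEe, ← mul_pow, ← sq_abs, abs_sub_comm]
          exact pow_le_pow_left₀ (abs_nonneg _) (hy j) 2
      _ = N * C ^ 2 * e := by simp [mul_assoc]
  have hmass : offSupportMass x x' ≤ 4 / ξ ^ 2 * e + 1 / δ ^ 2 * e := by
    have hξe : 0 ≤ 4 / ξ ^ 2 * e := by positivity
    have hδe : 0 ≤ 1 / δ ^ 2 * e := by positivity
    rcases le_total (√e) δ with hEδ | hEδ
    · have hrow : ∀ i, x i = 0 → ξ / 2 ≤ (G *ᵥ y') i - r := fun i hi => by
        have e1 : |(G *ᵥ y') i - (G *ᵥ y) i| ≤ N * (C * √e) := by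
          calc |(G *ᵥ y') i - (G *ᵥ y) i| ≤ ∑ j, |y' j - y j| := abs_mulVec_sub_le hG y' y i
            _ ≤ ∑ _j : Fin N, C * √e := Finset.sum_le_sum fun j _ => hy j
            _ = N * (C * √e) := by simp
        have e2 : (N + 1) * C * √e ≤ ξ / 2 := by
          calc (N + 1) * C * √e ≤ (N + 1) * C * δ := by gcongr
            _ = ξ / 2 := by rw [hδ]; field_simp
        have := (abs_le.1 e1).1
        have := (abs_le.1 hr).2
        have := hgap i hi
        linarith
      have h1 : ξ ^ 2 / 4 * offSupportMass x x' ≤ ∑ i, x' i * ((G *ᵥ y') i - r) ^ 2 := by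
        rw [offSupportMass, Finset.mul_sum]
        refine Finset.sum_le_sum fun i _ => ?_
        split_ifs with hi
        · have h2 : ξ ^ 2 / 4 ≤ ((G *ᵥ y') i - r) ^ 2 := by
            have := pow_le_pow_left₀ (by positivity) (hrow i hi) 2
            linarith
          have := mul_le_mul_of_nonneg_left h2 (hx'.1 i)
          linarith
        · have := mul_nonneg (hx'.1 i) (sq_nonneg ((G *ᵥ y') i - r))
          linarith
      have h2 : offSupportMass x x' ≤ 4 / ξ ^ 2 * e := by
        rw [div_mul_eq_mul_div, le_div_iff₀ (by positivity)]
        linarith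
      linarith
    · have h1 := offSupportMass_le_one (p := x) hx'
      have h2 : 1 ≤ 1 / δ ^ 2 * e := by
        rw [one_div_mul_eq_div, le_div_iff₀ (by positivity), one_mul, ← hEe]
        exact pow_le_pow_left₀ hδ0.le hEδ 2
      linarith
  linarith

/-- The error bound that drives the linear rate: the divergence from the equilibrium is controlled
by the variance of the gradients under the current strategies. -/
lemma exists_KL_error_bound {M N : ℕ} {G : Matrix (Fin M) (Fin N) ℝ}
    (hG : ∀ i j, |G i j| ≤ 1) {x : Fin M → ℝ}
    {y : Fin N → ℝ} (h : IsNashEquilibrium G (x, y))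
    (huniq : ∀ z, IsNashEquilibrium G z → z = (x, y)) {ε : ℝ} (hε : 0 < ε) (hε1 : ε ≤ 1) :
    ∃ C : ℝ, 0 < C ∧ ∀ x' ∈ stdSimplex ℝ (Fin M), ∀ y' ∈ stdSimplex ℝ (Fin N),
      (∀ i, 0 < x' i) → (∀ j, 0 < y' j) →
      (∀ i, x i ≠ 0 → ε ≤ x' i) → (∀ j, y j ≠ 0 → ε ≤ y' j) → ∀ r s : ℝ,
      KL x x' + KL y y' ≤
        C * (∑ i, x' i * ((G *ᵥ y') i - r) ^ 2 + ∑ j, y' j * ((x' ᵥ* G) j - s) ^ 2) := by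
  obtain ⟨C₁, hC₁, h₁⟩ := exists_quadratic_error_bound hG h huniq hε
  obtain ⟨C₂, hC₂, h₂⟩ := exists_quadratic_error_bound (G := -Gᵀ)
    (fun j i => by simpa using hG i j) h.swap (unique_swap huniq) hε
  refine ⟨1 / ε * (C₁ + C₂), by positivity, fun x' hx' y' hy' hx0 hy0 hxε hyε r s => ?_⟩
  have b₁ := h₁ x' hx' y' hy' hxε hyε r s
  have b₂ := h₂ y' hy' x' hx' hyε hxε (-s) (-r)
  rw [vecMul_neg, vecMul_transpose, neg_mulVec, mulVec_transpose] at b₂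
  have e1 : ∀ a b : ℝ, (-a - -b) ^ 2 = (a - b) ^ 2 := fun a b => by ring
  simp only [Pi.neg_apply, e1] at b₂
  have k₁ := KL_le_sum_sq_add_offSupportMass h.1 hx' hx0 hε hε1 hxε
  have k₂ := KL_le_sum_sq_add_offSupportMass h.2.1 hy' hy0 hε hε1 hyε
  have hinv : 0 ≤ 1 / ε := by positivity
  have := mul_le_mul_of_nonneg_left (add_le_add b₁ b₂) hinv
  linarith

/-! ### One step of the optimistic method -/

/-- Both components of the profile are probability vectors with positive entries. -/
def IsInterior {M N : ℕ} (z : Profile M N) : Prop :=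
  (z.1 ∈ stdSimplex ℝ (Fin M) ∧ ∀ i, 0 < z.1 i) ∧ (z.2 ∈ stdSimplex ℝ (Fin N) ∧ ∀ j, 0 < z.2 j)

lemma IsInterior.mwuStep {M N : ℕ} {v : Profile M N} (hv : IsInterior v)
    (G : Matrix (Fin M) (Fin N) ℝ) (η : ℝ) (z : Profile M N) : IsInterior (mwuStep G η v z) :=
  ⟨⟨reweight_mem_stdSimplex hv.1.1 _, reweight_pos hv.1.1 hv.1.2 _⟩,
    ⟨reweight_mem_stdSimplex hv.2.1 _, reweight_pos hv.2.1 hv.2.2 _⟩⟩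

lemma IsInterior.KLProfile_nonneg {M N : ℕ} {z z' : Profile M N} (hz : IsInterior z)
    (hz' : IsInterior z') : 0 ≤ KLProfile z z' :=
  add_nonneg (KL_nonneg hz.1.1 hz'.1.1 hz'.1.2) (KL_nonneg hz.2.1 hz'.2.1 hz'.2.2)

lemma mwuStep_eq {M N : ℕ} (G : Matrix (Fin M) (Fin N) ℝ) (η : ℝ) (v z : Profile M N) :
    mwuStep G η v z = (reweight v.1 (fun i => -η * (G *ᵥ z.2) i),
      reweight v.2 (fun j => η * (z.1 ᵥ* G) j)) := by
  have h : gradY G z = z.1 ᵥ* G := by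
    funext j
    simp only [gradY, vecMul, dotProduct, mul_comm]
  rw [mwuStep, h]
  rfl

lemma sum_sub_mul_sub_le {d : ℕ} {u w a b : Fin d → ℝ} {η β : ℝ} (hη : 0 ≤ η)
    (hab : ∀ i, |b i - a i| ≤ η * β) :
    ∑ i, (u i - w i) * (b i - a i) ≤ η / 2 * ((∑ i, |u i - w i|) ^ 2 + β ^ 2) := by
  calc ∑ i, (u i - w i) * (b i - a i) ≤ ∑ i, |u i - w i| * (η * β) :=
        Finset.sum_le_sum fun i _ => (le_abs_self _).trans (by
          rw [abs_mul]; exact mul_le_mul_of_nonneg_left (hab i) (abs_nonneg _))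
    _ = (∑ i, |u i - w i|) * (η * β) := by rw [Finset.sum_mul]
    _ ≤ _ := by nlinarith [mul_nonneg hη (sq_nonneg ((∑ i, |u i - w i|) - β))]

lemma sq_sum_abs_sub_le_add_KL {d : ℕ} {w v z : Fin d → ℝ} (hw : w ∈ stdSimplex ℝ (Fin d))
    (hv : v ∈ stdSimplex ℝ (Fin d)) (hv0 : ∀ i, 0 < v i) (hz : z ∈ stdSimplex ℝ (Fin d))
    (hz0 : ∀ i, 0 < z i) : (∑ i, |w i - z i|) ^ 2 ≤ 8 * (KL w v + KL v z) := by
  have h1 := sq_sum_abs_sub_le_KL hw hv hv0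
  have h2 := sq_sum_abs_sub_le_KL hv hz hz0
  have h3 : ∑ i, |w i - z i| ≤ ∑ i, |w i - v i| + ∑ i, |v i - z i| := by
    rw [← Finset.sum_add_distrib]
    exact Finset.sum_le_sum fun i _ => abs_sub_le _ _ _
  have h4 : 0 ≤ ∑ i, |w i - z i| := Finset.sum_nonneg fun i _ => abs_nonneg _
  have h5 := pow_le_pow_left₀ h4 h3 2
  nlinarith [sq_nonneg (∑ i, |w i - v i| - ∑ i, |v i - z i|)]

/-- The potential `KL(z*, ẑ_t) + KL(ẑ_t, z_{t-1}) / 2` decreases by a fixed fraction of the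
distance travelled: `v` and `z` stand for `ẑ_t` and `z_{t-1}`. The equilibrium property removes
the first-order term of the three-point identity, and the prediction error is paid for by the
negative terms together with the second term of the potential. -/
lemma potential_step_le {M N : ℕ} {G : Matrix (Fin M) (Fin N) ℝ} (hG : ∀ i j, |G i j| ≤ 1)
    {x : Fin M → ℝ} {y : Fin N → ℝ} (h : IsNashEquilibrium G (x, y)) {η : ℝ} (hη : 0 < η)
    (hη8 : η ≤ 1 / 8) {v z w u : Profile M N} (hv : IsInterior v) (hz : IsInterior z)
    (hw : w = mwuStep G η v z) (hu : u = mwuStep G η v w) :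
    KLProfile (x, y) u + 1 / 2 * KLProfile u w + 1 / 4 * (KLProfile u w + KLProfile w v) ≤
      KLProfile (x, y) v + 1 / 2 * KLProfile v z := by
  have hwI : IsInterior w := hw ▸ hv.mwuStep G η z
  have huI : IsInterior u := hu ▸ hv.mwuStep G η w
  have hw1 : w.1 = reweight v.1 (fun i => -η * (G *ᵥ z.2) i) := by rw [hw, mwuStep_eq]
  have hw2 : w.2 = reweight v.2 (fun j => η * (z.1 ᵥ* G) j) := by rw [hw, mwuStep_eq]
  have hu1 : u.1 = reweight v.1 (fun i => -η * (G *ᵥ w.2) i) := by rw [hu, mwuStep_eq]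
  have hu2 : u.2 = reweight v.2 (fun j => η * (w.1 ᵥ* G) j) := by rw [hu, mwuStep_eq]
  have id1 := KL_reweight_eq h.1 hv.1.1 hv.1.2 (fun i => -η * (G *ᵥ z.2) i)
    (fun i => -η * (G *ᵥ w.2) i)
  have id2 := KL_reweight_eq h.2.1 hv.2.1 hv.2.2 (fun j => η * (z.1 ᵥ* G) j)
    (fun j => η * (w.1 ᵥ* G) j)
  rw [← hw1, ← hu1] at id1
  rw [← hw2, ← hu2] at id2
  have er1 := sum_sub_mul_sub_le (u := u.1) (w := w.1) (a := fun i => -η * (G *ᵥ z.2) i)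
    (b := fun i => -η * (G *ᵥ w.2) i) (β := ∑ j, |w.2 j - z.2 j|) hη.le fun i => by
      rw [← mul_sub, abs_mul, abs_neg, abs_of_pos hη]
      exact mul_le_mul_of_nonneg_left (abs_mulVec_sub_le hG _ _ i) hη.le
  have er2 := sum_sub_mul_sub_le (u := u.2) (w := w.2) (a := fun j => η * (z.1 ᵥ* G) j)
    (b := fun j => η * (w.1 ᵥ* G) j) (β := ∑ i, |w.1 i - z.1 i|) hη.le fun j => by
      rw [← mul_sub, abs_mul, abs_of_pos hη]
      exact mul_le_mul_of_nonneg_left (abs_vecMul_sub_le hG _ _ j) hη.le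
  have lin : ∑ i, (w.1 i - x i) * (-η * (G *ᵥ w.2) i) +
      ∑ j, (w.2 j - y j) * (η * (w.1 ᵥ* G) j) ≤ 0 := by
    have e1 : ∑ i, (w.1 i - x i) * (-η * (G *ᵥ w.2) i) =
        -η * (payoff G w.1 w.2 - payoff G x w.2) := by
      rw [payoff_eq_sum_mulVec, payoff_eq_sum_mulVec, ← Finset.sum_sub_distrib, Finset.mul_sum]
      exact Finset.sum_congr rfl fun i _ => by ring
    have e2 : ∑ j, (w.2 j - y j) * (η * (w.1 ᵥ* G) j) =
        η * (payoff G w.1 w.2 - payoff G w.1 y) := by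
      rw [payoff_eq_sum_vecMul, payoff_eq_sum_vecMul, ← Finset.sum_sub_distrib, Finset.mul_sum]
      exact Finset.sum_congr rfl fun i _ => by ring
    have e3 := h.2.2.1 w.2 hwI.2.1
    have e4 := h.2.2.2 w.1 hwI.1.1
    rw [e1, e2]
    nlinarith
  have p1 := sq_sum_abs_sub_le_KL huI.1.1 hwI.1.1 hwI.1.2
  have p2 := sq_sum_abs_sub_le_KL huI.2.1 hwI.2.1 hwI.2.2
  have q1 := sq_sum_abs_sub_le_add_KL hwI.1.1 hv.1.1 hv.1.2 hz.1.1 hz.1.2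
  have q2 := sq_sum_abs_sub_le_add_KL hwI.2.1 hv.2.1 hv.2.2 hz.2.1 hz.2.2
  have shrink : ∀ S T : ℝ, 0 ≤ S → S ≤ T → η / 2 * S ≤ 1 / 16 * T := fun S T hS hST =>
    (mul_le_mul_of_nonneg_right (by linarith) hS).trans
      (mul_le_mul_of_nonneg_left hST (by norm_num))
  have s1 := shrink _ _ (add_nonneg (sq_nonneg _) (sq_nonneg _)) (add_le_add p1 q2)
  have s2 := shrink _ _ (add_nonneg (sq_nonneg _) (sq_nonneg _)) (add_le_add p2 q1)
  have n1 := KL_nonneg hwI.1.1 hv.1.1 hv.1.2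
  have n2 := KL_nonneg hwI.2.1 hv.2.1 hv.2.2
  simp only [KLProfile]
  linarith

/-- One player's half of the variance bound: `g₀` and `g` are the predicted and the observed
gradient, and `g'` is the gradient at the new iterate. -/
lemma exists_sum_mul_sq_gradient_sub_le {d : ℕ} {v : Fin d → ℝ}
    (hv : v ∈ stdSimplex ℝ (Fin d)) (hv0 : ∀ i, 0 < v i) {σ β : ℝ} (hσ : σ ≠ 0)
    (hσ8 : |σ| ≤ 1 / 8) {g₀ g g' : Fin d → ℝ} (hg₀ : ∀ i, |g₀ i| ≤ 1) (hg : ∀ i, |g i| ≤ 1)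
    (hgg' : ∀ i, |g' i - g i| ≤ β) {w u : Fin d → ℝ}
    (hw : w = reweight v (fun i => σ * g₀ i)) (hu : u = reweight v (fun i => σ * g i)) :
    ∃ r : ℝ, σ ^ 2 * ∑ i, u i * (g' i - r) ^ 2 ≤
      32 * (KL u w + KL w v) + 2 * σ ^ 2 * β ^ 2 := by
  have hbd : ∀ f : Fin d → ℝ, (∀ i, |f i| ≤ 1) → ∀ i, |σ * f i| ≤ 1 / 8 := fun f hf i => by
    rw [abs_mul]
    exact (mul_le_of_le_one_right (abs_nonneg σ) (hf i)).trans hσ8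
  obtain ⟨ρ, hρ⟩ := exists_sum_mul_sq_sub_le hv hv0 (hbd g₀ hg₀) (hbd g hg)
  have huS : u ∈ stdSimplex ℝ (Fin d) := hu ▸ reweight_mem_stdSimplex hv _
  rw [← hw, ← hu] at hρ
  refine ⟨ρ / σ, ?_⟩
  have hpt := Finset.sum_le_sum fun i (_ : i ∈ Finset.univ) =>
    show σ ^ 2 * (u i * (g' i - ρ / σ) ^ 2) ≤
        2 * (u i * (σ * g i - ρ) ^ 2) + u i * (2 * σ ^ 2 * β ^ 2) by
      have e1 : σ * (g' i - ρ / σ) = σ * (g' i - g i) + (σ * g i - ρ) := by field_simp; ring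
      have e2 : σ ^ 2 * (g' i - ρ / σ) ^ 2 = (σ * (g' i - g i) + (σ * g i - ρ)) ^ 2 := by
        rw [← mul_pow, e1]
      have e3 : (g' i - g i) ^ 2 ≤ β ^ 2 := by
        rw [← sq_abs]; exact pow_le_pow_left₀ (abs_nonneg _) (hgg' i) 2
      have e4 : σ ^ 2 * (g' i - ρ / σ) ^ 2 ≤ 2 * (σ * g i - ρ) ^ 2 + 2 * σ ^ 2 * β ^ 2 := by
        rw [e2]
        nlinarith [sq_nonneg (σ * (g' i - g i) - (σ * g i - ρ)),
          mul_le_mul_of_nonneg_left e3 (sq_nonneg σ)]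
      have := mul_le_mul_of_nonneg_left e4 (huS.1 i)
      linarith
  rw [Finset.sum_add_distrib, ← Finset.mul_sum, ← Finset.mul_sum, ← Finset.sum_mul, huS.2] at hpt
  linarith

/-- The distance travelled in a step bounds the variance of the gradients at the new iterate. -/
lemma exists_gradient_variance_le {M N : ℕ} {G : Matrix (Fin M) (Fin N) ℝ}
    (hG : ∀ i j, |G i j| ≤ 1) {η : ℝ} (hη : 0 < η)
    (hη8 : η ≤ 1 / 8) {v z w u : Profile M N} (hv : IsInterior v) (hz : IsInterior z)
    (hw : w = mwuStep G η v z) (hu : u = mwuStep G η v w) :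
    ∃ r s : ℝ, η ^ 2 * (∑ i, u.1 i * ((G *ᵥ u.2) i - r) ^ 2 +
      ∑ j, u.2 j * ((u.1 ᵥ* G) j - s) ^ 2) ≤ 33 * (KLProfile u w + KLProfile w v) := by
  have hwI : IsInterior w := hw ▸ hv.mwuStep G η z
  have huI : IsInterior u := hu ▸ hv.mwuStep G η w
  obtain ⟨r, hr⟩ := exists_sum_mul_sq_gradient_sub_le hv.1.1 hv.1.2 (σ := -η)
    (neg_ne_zero.2 hη.ne') (by rwa [abs_neg, abs_of_pos hη])
    (g₀ := G *ᵥ z.2) (g := G *ᵥ w.2) (g' := G *ᵥ u.2)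
    (abs_mulVec_le_one hG hz.2.1) (abs_mulVec_le_one hG hwI.2.1)
    (abs_mulVec_sub_le hG u.2 w.2) (w := w.1) (u := u.1)
    (by rw [hw, mwuStep_eq]) (by rw [hu, mwuStep_eq])
  obtain ⟨s, hs⟩ := exists_sum_mul_sq_gradient_sub_le hv.2.1 hv.2.2 (σ := η)
    hη.ne' (by rwa [abs_of_pos hη])
    (g₀ := z.1 ᵥ* G) (g := w.1 ᵥ* G) (g' := u.1 ᵥ* G)
    (abs_vecMul_le_one hG hz.1.1) (abs_vecMul_le_one hG hwI.1.1)
    (abs_vecMul_sub_le hG u.1 w.1) (w := w.2) (u := u.2)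
    (by rw [hw, mwuStep_eq]) (by rw [hu, mwuStep_eq])
  refine ⟨r, s, ?_⟩
  rw [neg_sq] at hr
  have p1 := sq_sum_abs_sub_le_KL huI.1.1 hwI.1.1 hwI.1.2
  have p2 := sq_sum_abs_sub_le_KL huI.2.1 hwI.2.1 hwI.2.2
  have hη2 : 2 * η ^ 2 ≤ 1 / 4 := by nlinarith
  have shrink : ∀ S T : ℝ, 0 ≤ S → S ≤ 4 * T → 2 * η ^ 2 * S ≤ T := fun S T hS hST =>
    (mul_le_mul_of_nonneg_right hη2 hS).trans (by linarith)
  have s1 := shrink _ _ (sq_nonneg _) p1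
  have s2 := shrink _ _ (sq_nonneg _) p2
  have n1 := KL_nonneg hwI.1.1 hv.1.1 hv.1.2
  have n2 := KL_nonneg hwI.2.1 hv.2.1 hv.2.2
  simp only [KLProfile]
  linarith

/-- The iterate inherits the divergence bound of the point it was computed from, up to the
distance travelled. -/
lemma KL_reweight_le {d : ℕ} {p v : Fin d → ℝ} (hp : p ∈ stdSimplex ℝ (Fin d))
    (hv : v ∈ stdSimplex ℝ (Fin d)) (hv0 : ∀ i, 0 < v i) {a : Fin d → ℝ}
    (ha : ∀ i, |a i| ≤ 1 / 8) {ε : ℝ} (hε : 0 < ε) (hε1 : ε ≤ 1)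
    (hvε : ∀ i, p i ≠ 0 → ε ≤ v i) :
    KL p (reweight v a) ≤ 2 / ε * (10 * KL p v + 8 * KL (reweight v a) v) := by
  have hw := reweight_mem_stdSimplex hv a
  have hw0 := reweight_pos hv hv0 a
  have lw := log_reweight hv hv0 a
  have hα := abs_le.1 (abs_log_reweight_normalizer_le hv ha)
  set α := Real.log (∑ j, v j * Real.exp (a j))
  set w := reweight v a
  have lwv : ∀ i, Real.log (w i / v i) = a i - α := fun i => by
    rw [Real.log_div (hw0 i).ne' (hv0 i).ne', lw i]; ring
  have hlow : ∀ i, v i ≤ 2 * w i := fun i => by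
    have h := Real.add_one_le_exp (Real.log (w i / v i))
    rw [Real.exp_log (div_pos (hw0 i) (hv0 i)), lwv, le_div_iff₀ (hv0 i)] at h
    have := abs_le.1 (ha i)
    nlinarith [hv0 i]
  have hupp : ∀ i, w i ≤ 2 * v i := fun i => by
    have h := Real.add_one_le_exp (-Real.log (w i / v i))
    rw [Real.exp_neg, Real.exp_log (div_pos (hw0 i) (hv0 i)), inv_div, lwv,
      le_div_iff₀ (hw0 i)] at h
    have := abs_le.1 (ha i)
    nlinarith [hw0 i]
  have hoff : offSupportMass p w ≤ 2 * KL p v := by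
    refine le_trans ?_ (mul_le_mul_of_nonneg_left (offSupportMass_le_KL hp hv hv0) zero_le_two)
    rw [offSupportMass, offSupportMass, Finset.mul_sum]
    exact Finset.sum_le_sum fun i _ => by split_ifs <;> simp [hupp i]
  have hsq : ∑ i, (p i - w i) ^ 2 ≤ 8 * KL p v + 8 * KL w v := by
    have h1 := sum_sq_sub_le_KL hp hv hv0
    have h2 := sum_sq_sub_le_KL hw hv hv0
    have h3 : ∑ i, (p i - w i) ^ 2 ≤ ∑ i, (2 * (p i - v i) ^ 2 + 2 * (w i - v i) ^ 2) :=
      Finset.sum_le_sum fun i _ => by nlinarith [sq_nonneg ((p i - v i) + (w i - v i))]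
    rw [Finset.sum_add_distrib, ← Finset.mul_sum, ← Finset.mul_sum] at h3
    linarith
  have hmain := KL_le_sum_sq_add_offSupportMass hp hw hw0 (ε := ε / 2) (by positivity)
    (by linarith) fun i hi => by linarith [hvε i hi, hlow i]
  refine hmain.trans ?_
  rw [one_div_div]
  exact mul_le_mul_of_nonneg_left (by linarith) (by positivity)

lemma KLProfile_mwuStep_le {M N : ℕ} {G : Matrix (Fin M) (Fin N) ℝ}
    (hG : ∀ i j, |G i j| ≤ 1) {x : Fin M → ℝ} {y : Fin N → ℝ}
    (hx : x ∈ stdSimplex ℝ (Fin M)) (hy : y ∈ stdSimplex ℝ (Fin N)) {η : ℝ} (hη : 0 < η)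
    (hη8 : η ≤ 1 / 8) {v z : Profile M N} (hv : IsInterior v) (hz : IsInterior z)
    {ε : ℝ} (hε : 0 < ε) (hε1 : ε ≤ 1) (hxε : ∀ i, x i ≠ 0 → ε ≤ v.1 i)
    (hyε : ∀ j, y j ≠ 0 → ε ≤ v.2 j) :
    KLProfile (x, y) (mwuStep G η v z) ≤
      2 / ε * (10 * KLProfile (x, y) v + 8 * KLProfile (mwuStep G η v z) v) := by
  rw [mwuStep_eq]
  have hbd : ∀ s : ℝ, |s| ≤ 1 → η * |s| ≤ 1 / 8 := fun s hs =>
    (mul_le_of_le_one_right hη.le hs).trans hη8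
  have h1 := KL_reweight_le hx hv.1.1 hv.1.2 (a := fun i => -η * (G *ᵥ z.2) i)
    (fun i => by
      rw [abs_mul, abs_neg, abs_of_pos hη]
      exact hbd _ (abs_mulVec_le_one hG hz.2.1 i)) hε hε1 hxε
  have h2 := KL_reweight_le hy hv.2.1 hv.2.2 (a := fun j => η * (z.1 ᵥ* G) j)
    (fun j => by
      rw [abs_mul, abs_of_pos hη]
      exact hbd _ (abs_vecMul_le_one hG hz.1.1 j)) hε hε1 hyε
  simp only [KLProfile]
  linarith

/-! ### Linear convergence -/

lemma isInterior_uniformProfile {M N : ℕ} (hM : 0 < M) (hN : 0 < N) :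
    IsInterior (uniformProfile M N) := by
  have hM' : (0 : ℝ) < M := by exact_mod_cast hM
  have hN' : (0 : ℝ) < N := by exact_mod_cast hN
  refine ⟨⟨⟨fun i => ?_, ?_⟩, fun i => ?_⟩, ⟨⟨fun j => ?_, ?_⟩, fun j => ?_⟩⟩ <;>
    simp only [uniformProfile] <;> first | positivity | simp [hM'.ne', hN'.ne']

lemma isInterior_omwuState {M N : ℕ} (hM : 0 < M) (hN : 0 < N) (G : Matrix (Fin M) (Fin N) ℝ)
    (η : ℝ) (t : ℕ) : IsInterior (omwuState G η t).1 ∧ IsInterior (omwuState G η t).2 := by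
  induction t with
  | zero => exact ⟨isInterior_uniformProfile hM hN, isInterior_uniformProfile hM hN⟩
  | succ t ih => exact ⟨ih.2.mwuStep G η _, ih.2.mwuStep G η _⟩

lemma KLProfile_self {M N : ℕ} (z : Profile M N) : KLProfile z z = 0 := by
  have h : ∀ {d : ℕ} (p : Fin d → ℝ), KL p p = 0 := fun p =>
    Finset.sum_eq_zero fun i _ => by
      by_cases hi : p i = 0
      · simp [hi]
      · simp [div_self hi]
  simp [KLProfile, h]

/-- The potential contracts by a factor `1 + c η²` in every step. -/
lemma exists_potential_le {M N : ℕ} {G : Matrix (Fin M) (Fin N) ℝ} (hG : ∀ i j, |G i j| ≤ 1)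
    {x : Fin M → ℝ} {y : Fin N → ℝ} (h : IsNashEquilibrium G (x, y))
    (huniq : ∀ z, IsNashEquilibrium G z → z = (x, y)) {L ε : ℝ}
    (hL : KLProfile (x, y) (uniformProfile M N) ≤ L) (hε : 0 < ε) (hε1 : ε ≤ 1)
    (hbound : ∀ z : Profile M N, IsInterior z → KLProfile (x, y) z ≤ L →
      (∀ i, x i ≠ 0 → ε ≤ z.1 i) ∧ ∀ j, y j ≠ 0 → ε ≤ z.2 j) :
    ∃ c : ℝ, 0 < c ∧ c ≤ 1 ∧ ∀ η : ℝ, 0 < η → η ≤ 1 / 8 → ∀ t : ℕ,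
      KLProfile (x, y) (omwuState G η t).2 +
        1 / 2 * KLProfile (omwuState G η t).2 (omwuState G η t).1 ≤
      L / (1 + c * η ^ 2) ^ t := by
  obtain ⟨C, hC, herr⟩ := exists_KL_error_bound hG h huniq hε hε1
  have hM : 0 < M := Fin.pos_iff_nonempty.2 (nonempty_of_mem_stdSimplex h.1)
  have hN : 0 < N := Fin.pos_iff_nonempty.2 (nonempty_of_mem_stdSimplex h.2.1)
  set c := min (1 / 4) (1 / (264 * C)) with hc
  have hc0 : 0 < c := lt_min (by norm_num) (by positivity)
  have hc4 : c ≤ 1 / 4 := min_le_left _ _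
  have hcC : c * (264 * C) ≤ 1 := by
    rw [← le_div_iff₀ (by positivity)]
    exact min_le_right _ _
  refine ⟨c, hc0, by linarith, fun η hη hη8 t => ?_⟩
  have hq1 : 1 ≤ 1 + c * η ^ 2 := by
    have : 0 ≤ c * η ^ 2 := by positivity
    linarith
  induction t with
  | zero => simpa [omwuState, KLProfile_self] using hL
  | succ t ih =>
    obtain ⟨hz, hv⟩ := isInterior_omwuState hM hN G η t
    obtain ⟨hw, hu⟩ := isInterior_omwuState hM hN G η (t + 1)
    have hw_eq : (omwuState G η (t + 1)).1 =
      mwuStep G η (omwuState G η t).2 (omwuState G η t).1 := rfl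
    have hu_eq : (omwuState G η (t + 1)).2 =
      mwuStep G η (omwuState G η t).2 (omwuState G η (t + 1)).1 := rfl
    have hL0 : 0 ≤ L := (add_nonneg
      (KL_nonneg h.1 (isInterior_uniformProfile hM hN).1.1 (isInterior_uniformProfile hM hN).1.2)
      (KL_nonneg h.2.1 (isInterior_uniformProfile hM hN).2.1
        (isInterior_uniformProfile hM hN).2.2)).trans hL
    have hstep := potential_step_le hG h hη hη8 hv hz hw_eq hu_eq
    obtain ⟨r, s, hvar⟩ := exists_gradient_variance_le hG hη hη8 hv hz hw_eq hu_eq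
    set v := (omwuState G η t).2
    set z := (omwuState G η t).1
    set w := (omwuState G η (t + 1)).1
    set u := (omwuState G η (t + 1)).2
    have nuw := hu.KLProfile_nonneg hw
    have nwv := hw.KLProfile_nonneg hv
    have hΘL : L / (1 + c * η ^ 2) ^ t ≤ L := div_le_self hL0 (one_le_pow₀ hq1)
    obtain ⟨hxε, hyε⟩ := hbound u hu (by linarith)
    have hKL := herr u.1 hu.1.1 u.2 hu.2.1 hu.1.2 hu.2.2 hxε hyε r s
    change KLProfile (x, y) u ≤ _ at hKL
    -- The two parts of the new potential each cost at most an eighth of the distance travelled.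
    have hfirst : c * η ^ 2 * KLProfile (x, y) u ≤ 1 / 8 * (KLProfile u w + KLProfile w v) := by
      have e1 := mul_le_mul_of_nonneg_left hKL (by positivity : 0 ≤ c * η ^ 2)
      have e2 := mul_le_mul_of_nonneg_left hvar (by positivity : 0 ≤ c * C)
      have e3 := mul_le_mul_of_nonneg_right hcC (add_nonneg nuw nwv)
      linarith
    have hsecond : c * η ^ 2 * (1 / 2 * KLProfile u w) ≤ 1 / 8 * KLProfile u w := by
      have e1 : c * η ^ 2 ≤ 1 / 4 := by nlinarith
      have := mul_le_mul_of_nonneg_right e1 nuw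
      linarith
    have hcontr : (KLProfile (x, y) u + 1 / 2 * KLProfile u w) * (1 + c * η ^ 2) ≤
        KLProfile (x, y) v + 1 / 2 * KLProfile v z := by linarith
    rw [pow_succ, ← div_div, le_div_iff₀ (by linarith)]
    exact hcontr.trans ih

end MatrixGame

open MatrixGame in
theorem mainTheorem3 {M N : ℕ} (G : Matrix (Fin M) (Fin N) ℝ)
    (hG : ∀ i j, G i j ∈ Set.Icc (-1 : ℝ) 1)
    (zstar : MatrixGame.Profile M N)
    (hnash : MatrixGame.IsNashEquilibrium G zstar)
    (huniq : ∀ z : MatrixGame.Profile M N, MatrixGame.IsNashEquilibrium G z → z = zstar) :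
    ∃ A K c : ℝ, 0 < A ∧ 0 < K ∧ 0 < c ∧
      ∀ η : ℝ, 0 < η → η ≤ 1 / 8 → ∀ t : ℕ,
        MatrixGame.KLProfile zstar (MatrixGame.omwu G η t) ≤
          (A * (1 + c * η ^ 2) ^ (K / η ^ 4)) * (1 + c * η ^ 2) ^ (-(t : ℤ)) := by
  obtain ⟨x, y⟩ := zstar
  have hG' : ∀ i j, |G i j| ≤ 1 := fun i j => abs_le.2 (hG i j)
  have hM : 0 < M := Fin.pos_iff_nonempty.2 (nonempty_of_mem_stdSimplex hnash.1)
  have hN : 0 < N := Fin.pos_iff_nonempty.2 (nonempty_of_mem_stdSimplex hnash.2.1)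
  set L := KLProfile (x, y) (uniformProfile M N) with hL
  obtain ⟨ε₁, hε₁, hε₁1, hb₁⟩ := exists_le_of_KL_le hnash.1 L
  obtain ⟨ε₂, hε₂, hε₂1, hb₂⟩ := exists_le_of_KL_le hnash.2.1 L
  set ε := min ε₁ ε₂
  have hε : 0 < ε := lt_min hε₁ hε₂
  have hε1 : ε ≤ 1 := (min_le_left _ _).trans hε₁1
  have hbound : ∀ z : Profile M N, IsInterior z → KLProfile (x, y) z ≤ L →
      (∀ i, x i ≠ 0 → ε ≤ z.1 i) ∧ ∀ j, y j ≠ 0 → ε ≤ z.2 j := by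
    intro z hz hzL
    have n1 := KL_nonneg hnash.1 hz.1.1 hz.1.2
    have n2 := KL_nonneg hnash.2.1 hz.2.1 hz.2.2
    simp only [KLProfile] at hzL n1 n2
    exact ⟨fun i hi => (min_le_left _ _).trans (hb₁ _ hz.1.1 hz.1.2 (by linarith) i hi),
      fun j hj => (min_le_right _ _).trans (hb₂ _ hz.2.1 hz.2.2 (by linarith) j hj)⟩
  obtain ⟨c, hc, hc1, hpot⟩ := exists_potential_le hG' hnash huniq hL.ge hε hε1 hbound
  have hunif := isInterior_uniformProfile hM hN
  have hL0 : 0 ≤ L := add_nonneg (KL_nonneg hnash.1 hunif.1.1 hunif.1.2)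
    (KL_nonneg hnash.2.1 hunif.2.1 hunif.2.2)
  have h84 : 1 ≤ 84 / ε := by rw [le_div_iff₀ hε]; linarith
  refine ⟨2 * (84 / ε) * (L + 1), 1, c, by positivity, one_pos, hc, fun η hη hη8 t => ?_⟩
  have hcη : 0 ≤ c * η ^ 2 := by positivity
  have hq1 : 1 ≤ 1 + c * η ^ 2 := by linarith
  have hq2 : 1 + c * η ^ 2 ≤ 2 := by nlinarith
  have hrpow : 1 ≤ (1 + c * η ^ 2) ^ (1 / η ^ 4) := Real.one_le_rpow hq1 (by positivity)
  set R := (1 + c * η ^ 2) ^ (1 / η ^ 4)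
  rw [zpow_neg, zpow_natCast, ← div_eq_mul_inv]
  -- The factor `R ≥ 1` is not needed, since the potential contracts from the first step on.
  suffices hs : KLProfile (x, y) (omwu G η t) ≤
      2 * (84 / ε) * (L + 1) / (1 + c * η ^ 2) ^ t by
    refine hs.trans (div_le_div_of_nonneg_right ?_ (by positivity))
    exact le_mul_of_one_le_right (by positivity) hrpow
  cases t with
  | zero =>
    rw [pow_zero, div_one]
    change L ≤ _
    nlinarith
  | succ t =>
    obtain ⟨hz, hv⟩ := isInterior_omwuState hM hN G η t
    obtain ⟨hw, hu⟩ := isInterior_omwuState hM hN G η (t + 1)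
    have hΘ := hpot η hη hη8 t
    have hstep := potential_step_le hG' hnash hη hη8 hv hz rfl rfl
    change KLProfile (x, y) (mwuStep G η (omwuState G η t).2 (omwuState G η t).1) ≤ _
    change IsInterior (mwuStep G η (omwuState G η t).2 (omwuState G η t).1) at hw
    change IsInterior (mwuStep G η (omwuState G η t).2
      (mwuStep G η (omwuState G η t).2 (omwuState G η t).1)) at hu
    set v := (omwuState G η t).2
    set z := (omwuState G η t).1
    set w := mwuStep G η v z
    set u := mwuStep G η v w
    set P := L / (1 + c * η ^ 2) ^ t with hP
    have hPL : P ≤ L := div_le_self hL0 (one_le_pow₀ hq1)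
    have nvz := hv.KLProfile_nonneg hz
    have nuw := hu.KLProfile_nonneg hw
    have nwv := hw.KLProfile_nonneg hv
    have nu : 0 ≤ KLProfile (x, y) u := add_nonneg (KL_nonneg hnash.1 hu.1.1 hu.1.2)
      (KL_nonneg hnash.2.1 hu.2.1 hu.2.2)
    obtain ⟨hxε, hyε⟩ := hbound v hv (by linarith)
    have hlast : KLProfile (x, y) w ≤ 2 / ε * (10 * KLProfile (x, y) v + 8 * KLProfile w v) :=
      KLProfile_mwuStep_le hG' hnash.1 hnash.2.1 hη hη8 hv hz hε hε1 hxε hyε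
    have h42 : 10 * KLProfile (x, y) v + 8 * KLProfile w v ≤ 42 * P := by linarith
    have hfin : KLProfile (x, y) w ≤ 84 / ε * P := by
      refine hlast.trans ((mul_le_mul_of_nonneg_left h42 (by positivity)).trans_eq ?_)
      ring
    refine hfin.trans ?_
    have hqt : 0 < (1 + c * η ^ 2) ^ t := by positivity
    rw [pow_succ, ← div_div, le_div_iff₀ (by linarith), le_div_iff₀ hqt]
    have hPt : P * (1 + c * η ^ 2) ^ t = L := div_mul_cancel₀ _ hqt.ne'
    calc 84 / ε * P * (1 + c * η ^ 2) * (1 + c * η ^ 2) ^ t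
        = 84 / ε * L * (1 + c * η ^ 2) := by rw [← hPt]; ring
      _ ≤ 84 / ε * (L + 1) * 2 := by gcongr; linarith
      _ = 2 * (84 / ε) * (L + 1) := by ring
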